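/- Let $a>0$, let $V(\phi)=2\phi^2(\phi-\tanh a)(\phi-\coth a)$, let $\phi(x)=\dfrac{\sinh 2a}{\cosh 2a+\cosh 2x}$ be the static lump of the equation $\phi_{tt}-\phi_{xx}+V'(\phi)=0$, and let $$U(x)=V''(\phi(x))=4-24\,\frac{1+\cosh(2x)\cosh(2a)}{(\cosh(2x)+\cosh(2a))^2}.$$ For complex parameters, let $H\ell(p,q;\alpha,\beta,\gamma,\delta;z)$ denote the local Heun function: the solution of $$H''(z)+\Big(\frac{\gamma}{z}+\frac{\delta}{z-1}+\frac{\epsilon}{z-p}\Big)H'(z)+\frac{\alpha\beta z-q}{z(z-1)(z-p)}H(z)=0,\qquad \epsilon=\alpha+\beta-\gamma-\delta+1,$$ which is analytic at $z=0$ with $H\ell(p,q;\alpha,\beta,\gamma,\delta;0)=1$, continued analytically along the segment from $0$ to $z$; at the singular point $z=1$ its value is the limit along $[0,1)$. Then the Schrödinger operator $-\partial_x^2+U(x)$ on $L^2(\mathbb R)$ has a lowest eigenvalue $\lambda_{-1}$ (the ground-state eigenvalue), it is negative, and $\lambda=\lambda_{-1}$ satisfies the connection equation $$H\ell(p,q;\alpha,\beta,\gamma,\delta;1)\,H\ell(1-p,\alpha\beta-q;\alpha,\beta,\delta,\gamma;1)-1=0,$$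 where both values of $H\ell$ exist and are finite, and $$\alpha=\tfrac12\sqrt{4-\lambda}+3,\quad \beta=\tfrac12(\sqrt{4-\lambda}+7),\quad \gamma=\sqrt{4-\lambda}+1,\quad \delta=\tfrac12,$$ $$p=-\frac1{\sinh^2 a},\quad q=\frac{6\cosh(2a)(\sqrt{4-\lambda}+3)-(\sqrt{4-\lambda}+6)(\sqrt{4-\lambda}+1)}{4\sinh^2 a}.$$ -/

import Mathlib

open Filter Topology MeasureTheory

noncomputable section

/-- The quartic interaction potential with a false vacuum at `0`,
`V(φ) = 2 φ² (φ - tanh a) (φ - coth a)`. -/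
def interactionPotential (a φ : ℝ) : ℝ :=
  2 * φ ^ 2 * (φ - Real.tanh a) * (φ - Real.cosh a / Real.sinh a)

/-- The static lump `φ(x) = sinh 2a / (cosh 2a + cosh 2x)`. -/
def lump (a x : ℝ) : ℝ :=
  Real.sinh (2 * a) / (Real.cosh (2 * a) + Real.cosh (2 * x))

/-- The linearization potential about the lump, `U(x) = V''(φ(x))`. -/
def linearizationPotential (a x : ℝ) : ℝ :=
  iteratedDeriv 2 (interactionPotential a) (lump a x)

/-- The explicit form of the linearization potential. -/
theorem linearizationPotential_eq (a x : ℝ) (ha : 0 < a) :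
    linearizationPotential a x =
      4 - 24 * (1 + Real.cosh (2 * x) * Real.cosh (2 * a)) /
        (Real.cosh (2 * x) + Real.cosh (2 * a)) ^ 2 := by
  have hs : Real.sinh a ≠ 0 := (Real.sinh_pos_iff.2 ha).ne'
  have hc : Real.cosh a ≠ 0 := (Real.cosh_pos a).ne'
  have hd : Real.cosh (2 * a) + Real.cosh (2 * x) ≠ 0 :=
    (add_pos (Real.cosh_pos _) (Real.cosh_pos _)).ne'
  have hd' : Real.cosh (2 * x) + Real.cosh (2 * a) ≠ 0 := by rwa [add_comm]
  have key : ∀ t k φ : ℝ,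
      iteratedDeriv 2 (fun φ : ℝ => 2 * φ ^ 2 * (φ - t) * (φ - k)) φ
        = 24 * φ ^ 2 - 12 * (t + k) * φ + 4 * (t * k) := by
    intro t k φ
    have h1 : deriv (fun φ : ℝ => 2 * φ ^ 2 * (φ - t) * (φ - k))
        = fun φ => 8 * φ ^ 3 - 6 * (t + k) * φ ^ 2 + 4 * (t * k) * φ := by
      funext y
      have := (((((hasDerivAt_id y).pow 2).const_mul 2).mul
        ((hasDerivAt_id y).sub_const t)).mul ((hasDerivAt_id y).sub_const k)).deriv
      refine Eq.trans ?_ (this.trans ?_)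
      · rfl
      · simp
        ring
    rw [iteratedDeriv_succ, iteratedDeriv_one, h1]
    have := (((((hasDerivAt_id φ).pow 3).const_mul 8).sub
      (((hasDerivAt_id φ).pow 2).const_mul (6 * (t + k)))).add
      ((hasDerivAt_id φ).const_mul (4 * (t * k)))).deriv
    refine Eq.trans ?_ (this.trans ?_)
    · rfl
    · simp
      ring
  have h2 : linearizationPotential a x =
      24 * (lump a x) ^ 2 - 12 * (Real.tanh a + Real.cosh a / Real.sinh a) * lump a x
        + 4 * (Real.tanh a * (Real.cosh a / Real.sinh a)) := key _ _ _
  have h3 : Real.tanh a * (Real.cosh a / Real.sinh a) = 1 := by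
    rw [Real.tanh_eq_sinh_div_cosh]
    field_simp
  have h4 : (Real.tanh a + Real.cosh a / Real.sinh a) * Real.sinh (2 * a)
      = 2 * Real.cosh (2 * a) := by
    rw [Real.tanh_eq_sinh_div_cosh, Real.sinh_two_mul, Real.cosh_two_mul]
    field_simp
    ring
  have h5 : Real.cosh (2 * a) ^ 2 - Real.sinh (2 * a) ^ 2 = 1 := Real.cosh_sq_sub_sinh_sq _
  rw [h2, h3]
  have h6 : 12 * (Real.tanh a + Real.cosh a / Real.sinh a) * lump a x
      = 24 * Real.cosh (2 * a) / (Real.cosh (2 * a) + Real.cosh (2 * x)) := by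
    unfold lump
    rw [mul_assoc, ← mul_div_assoc, h4]
    ring
  rw [h6]
  unfold lump
  rw [add_comm (Real.cosh (2 * a)) (Real.cosh (2 * x))]
  field_simp
  linear_combination (-24) * h5

/-- `lam` is an eigenvalue of `-∂ₓ² + U(x)` on `L²(ℝ)`: there is a nonzero square-integrable
`η` with `-η'' + U η = lam η`.  As `U` is smooth and bounded and `lam` is real, this is the same
as being an eigenvalue of the self-adjoint operator with domain `H²(ℝ)`, and real-valued
eigenfunctions suffice. -/
def IsEigenvalueOfLinearization (a lam : ℝ) : Prop :=
  ∃ η : ℝ → ℝ, ContDiff ℝ 2 η ∧ MemLp η 2 volume ∧ η ≠ 0 ∧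
    ∀ x, -(iteratedDeriv 2 η x) + linearizationPotential a x * η x = lam * η x

/-- The ground-state eigenvalue is the lowest eigenvalue. -/
def IsGroundStateEigenvalue (a lam : ℝ) : Prop :=
  IsLeast {l : ℝ | IsEigenvalueOfLinearization a l} lam

/-- `H` satisfies at `z` Heun's equation
`H'' + (γ/z + δ/(z-1) + ε/(z-p)) H' + (αβ z - q)/(z(z-1)(z-p)) H = 0`,
`ε = α + β - γ - δ + 1`, with the denominators cleared. -/
def HeunEquationAt (p q α β γ δ : ℂ) (H : ℂ → ℂ) (z : ℂ) : Prop :=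
  z * (z - 1) * (z - p) * iteratedDeriv 2 H z
    + (γ * (z - 1) * (z - p) + δ * z * (z - p) + (α + β - γ - δ + 1) * z * (z - 1)) * deriv H z
    + (α * β * z - q) * H z = 0

/-- `H` is the local Heun function at `0` (the solution of Heun's equation that is analytic at
`0` with value `1` there), continued analytically along the half-open segment from `0` to `z`. -/
structure IsLocalHeunAlong (p q α β γ δ z : ℂ) (H : ℂ → ℂ) : Prop where
  analytic : AnalyticOnNhd ℂ H ((fun t : ℝ => (t : ℂ) * z) '' Set.Ico 0 1)
  map_zero : H 0 = 1
  heun : ∀ᶠ w in 𝓝 (0 : ℂ), HeunEquationAt p q α β γ δ H w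

/-- `w` is the value at `z` of the local Heun function: the limit at `z` of its analytic
continuation along the segment from `0` to `z`.  (If `z` is not a singular point, this is
the value of the analytic continuation.) -/
def IsLocalHeunValue (p q α β γ δ z w : ℂ) : Prop :=
  ∃ H : ℂ → ℂ, IsLocalHeunAlong p q α β γ δ z H ∧
    Tendsto (fun t : ℝ => H ((t : ℂ) * z)) (𝓝[<] 1) (𝓝 w)

open Classical in
/-- The local Heun function `Hℓ(p, q; α, β, γ, δ; z)`.  Where there is no finite value, it is
`0` by convention. -/
def localHeun (p q α β γ δ z : ℂ) : ℂ :=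
  if h : ∃ w, IsLocalHeunValue p q α β γ δ z w then h.choose else 0

/-- `p = -1 / sinh² a`. -/
def heunP (a : ℝ) : ℝ := -1 / Real.sinh a ^ 2

/-- The accessory parameter `q`. -/
def heunQ (a lam : ℝ) : ℝ :=
  (6 * Real.cosh (2 * a) * (√(4 - lam) + 3) - (√(4 - lam) + 6) * (√(4 - lam) + 1)) /
    (4 * Real.sinh a ^ 2)

def heunAlpha (lam : ℝ) : ℝ := √(4 - lam) / 2 + 3

def heunBeta (lam : ℝ) : ℝ := (√(4 - lam) + 7) / 2

def heunGamma (lam : ℝ) : ℝ := √(4 - lam) + 1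

def heunDelta : ℝ := 1 / 2

end

/-! Let w be the lump divided by its maximum and m = tanh² a. Writing η = w^r G(w) and λ = 4 - 4r²
turns the eigenvalue equation into a Fuchsian equation for G with singular points 0, 1, 1/m, ∞. The
solution regular at 0 has Taylor coefficients obeying a three-term recurrence whose limiting ratios
are 1 and m. If they decay like m^n, then G is analytic in |w| < 1/m, in particular at w = 1, the
image of x = 0, and w^r G(w) is a smooth even L² solution on the line.

Such an r is found by shooting (`exists_lumpCoeff_le`): the coefficients of positive index are
negative at r = 1 and positive at r = 2, so each vanishes somewhere between. A vanishing coefficient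
forces ratios at most m before it, and compactness yields one r in (1, 2] for all indices. Sturm
comparison with the zero mode makes G positive on [0, 1] (`re_pos_of_lumpEquation`), and a positive
solution with bounded logarithmic derivative bounds all eigenvalues from below
(`le_of_pos_solution`).

Finally, a Möbius change of variable sends G to a Heun solution H analytic along [0, 1] with H(0) =
1 and H(1) ≠ 0. By uniqueness of local Heun functions the two values are H(1) and 1/H(1), whose
product is 1. -/

/-! ### Shooting for a minimal solution of the recurrence -/

/-- The coefficients of the series `∑ cₙ wⁿ` for which `w ^ r * ∑ cₙ wⁿ` solves the
linearized equation with spectral parameter `4 - 4 r²`, as a function of the normalized lump `w`. -/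
noncomputable def lumpCoeff (m r : ℝ) : ℕ → ℝ
  | 0 => 1
  | 1 => (1 + m) * (2 * r - 3) * (r + 2) / (2 * (1 + 2 * r))
  | n + 2 => ((1 + m) * (n + r - 1 / 2) * (n + r + 3) * lumpCoeff m r (n + 1)
      - m * (n + r + 3) * (n + r - 2) * lumpCoeff m r n) / ((n + 2) * (n + 2 + 2 * r))

theorem lumpCoeff_add_two (m r : ℝ) (n : ℕ) :
    lumpCoeff m r (n + 2) = ((1 + m) * (n + r - 1 / 2) * (n + r + 3) * lumpCoeff m r (n + 1)
      - m * (n + r + 3) * (n + r - 2) * lumpCoeff m r n) / ((n + 2) * (n + 2 + 2 * r)) := by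
  rw [lumpCoeff]

theorem continuousOn_lumpCoeff (m : ℝ) (n : ℕ) :
    ContinuousOn (fun r => lumpCoeff m r n) (Set.Icc 1 2) := by
  induction n using Nat.strong_induction_on with
  | _ n ih =>
    match n, ih with
    | 0, _ => simpa [lumpCoeff] using continuousOn_const
    | 1, _ =>
      simp only [lumpCoeff]
      refine ContinuousOn.div (by fun_prop) (by fun_prop) fun r hr => ?_
      have := hr.1
      positivity
    | n + 2, ih =>
      simp only [lumpCoeff_add_two]
      have h1 := ih (n + 1) (by omega)
      have h0 := ih n (by omega)
      refine ContinuousOn.div (by fun_prop) (by fun_prop) fun r hr => ?_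
      have := hr.1
      positivity

section

variable {m r : ℝ}

/-- Once a ratio of consecutive coefficients is at least m, it stays so and the sign is frozen. The
recurrence index is n + 1 so that the factor n + 1 + r - 2 multiplying m x is nonnegative, which
allows m x to be replaced by y. -/
theorem lumpCoeff_step (hm0 : 0 < m) (hm1 : m < 1) (hr1 : 1 ≤ r) (n : ℕ) {x y : ℝ}
    (hy : 0 < y) (hxy : m * x ≤ y) :
    m * y ≤ ((1 + m) * ((n + 1 : ℕ) + r - 1 / 2) * ((n + 1 : ℕ) + r + 3) * y
      - m * ((n + 1 : ℕ) + r + 3) * ((n + 1 : ℕ) + r - 2) * x) /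
        (((n + 1 : ℕ) + 2) * ((n + 1 : ℕ) + 2 + 2 * r)) := by
  have hn : (0 : ℝ) ≤ n := n.cast_nonneg
  push_cast
  rw [le_div_iff₀ (by positivity)]
  have h1 : 0 ≤ (n + 1 + r + 3) * (n + 1 + r - 2) * (y - m * x) :=
    mul_nonneg (mul_nonneg (by linarith) (by linarith)) (by linarith)
  have h2 : 0 ≤ (1.5 * (n + r + 4) - m * (1.5 * (n + r + 3) + 2.5 - r ^ 2)) := by
    have : m * (1.5 * (n + r + 3) + 2.5 - r ^ 2) ≤ 1 * (1.5 * (n + r + 4)) := by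
      rcases le_total 0 (1.5 * (n + r + 3) + 2.5 - r ^ 2) with h | h
      · exact mul_le_mul hm1.le (by nlinarith) h (by norm_num)
      · nlinarith
    linarith
  have h3 := mul_nonneg h2 hy.le
  nlinarith [h1, h3]

theorem lumpCoeff_pos_of_pos (hm0 : 0 < m) (hm1 : m < 1) (hr1 : 1 ≤ r) {n : ℕ}
    (hy : 0 < lumpCoeff m r (n + 2)) (hxy : m * lumpCoeff m r (n + 1) ≤ lumpCoeff m r (n + 2))
    (k : ℕ) : 0 < lumpCoeff m r (n + k + 2) ∧
      m * lumpCoeff m r (n + k + 1) ≤ lumpCoeff m r (n + k + 2) := by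
  induction k with
  | zero => exact ⟨hy, hxy⟩
  | succ k ih =>
    have h := lumpCoeff_step hm0 hm1 hr1 (n + k) ih.1 ih.2
    have e : lumpCoeff m r (n + (k + 1) + 2) = _ := lumpCoeff_add_two m r (n + k + 1)
    rw [← lumpCoeff_add_two] at h
    exact ⟨(mul_pos hm0 ih.1).trans_le h, h⟩

theorem lumpCoeff_neg_of_neg (hm0 : 0 < m) (hm1 : m < 1) (hr1 : 1 ≤ r) {n : ℕ}
    (hy : lumpCoeff m r (n + 2) < 0) (hxy : lumpCoeff m r (n + 2) ≤ m * lumpCoeff m r (n + 1))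
    (k : ℕ) : lumpCoeff m r (n + k + 2) < 0 ∧
      lumpCoeff m r (n + k + 2) ≤ m * lumpCoeff m r (n + k + 1) := by
  induction k with
  | zero => exact ⟨hy, hxy⟩
  | succ k ih =>
    have h := lumpCoeff_step hm0 hm1 hr1 (n + k) (x := -lumpCoeff m r (n + k + 1))
      (y := -lumpCoeff m r (n + k + 2)) (by linarith [ih.1]) (by linarith [ih.2])
    have e : lumpCoeff m r (n + (k + 1) + 2) = _ := lumpCoeff_add_two m r (n + k + 1)
    have h' : m * -lumpCoeff m r (n + k + 2) ≤ -lumpCoeff m r (n + (k + 1) + 2) := by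
      rw [e, ← neg_div]
      refine h.trans_eq ?_
      congr 1
      ring
    have := mul_pos hm0 (neg_pos.2 ih.1)
    exact ⟨by linarith, by rw [← add_assoc] at h' ⊢; linarith⟩

/-- At r = 1 the series is that of √((1 - w)(1 - m w)), from the translation zero mode; only the
first coefficients are needed. -/
theorem lumpCoeff_one_one : lumpCoeff m 1 1 = -(1 + m) / 2 := by
  norm_num [lumpCoeff]
  ring

theorem lumpCoeff_one_two : lumpCoeff m 1 2 = -(1 - m) ^ 2 / 8 := by
  rw [lumpCoeff_add_two m 1 0, lumpCoeff_one_one]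
  norm_num [lumpCoeff]
  ring

theorem lumpCoeff_one_three : lumpCoeff m 1 3 = (1 + m) / 2 * lumpCoeff m 1 2 := by
  rw [lumpCoeff_add_two m 1 1]
  norm_num
  ring

theorem lumpCoeff_one_neg (hm0 : 0 < m) (hm1 : m < 1) (n : ℕ) : lumpCoeff m 1 (n + 1) < 0 := by
  have h2 : lumpCoeff m 1 2 < 0 := by
    rw [lumpCoeff_one_two]
    have : 0 < (1 - m) ^ 2 := pow_pos (by linarith) 2
    linarith
  have h3 : lumpCoeff m 1 3 < m * lumpCoeff m 1 2 := by
    rw [lumpCoeff_one_three]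
    nlinarith
  match n with
  | 0 => rw [lumpCoeff_one_one]; linarith
  | 1 => exact h2
  | n + 2 =>
    have h3' : lumpCoeff m 1 3 < 0 := by nlinarith
    have := (lumpCoeff_neg_of_neg hm0 hm1 le_rfl (n := 1) h3' h3.le n).1
    rwa [show n + 2 + 1 = 1 + n + 2 by ring]

theorem lumpCoeff_two_pos (hm0 : 0 < m) (hm1 : m < 1) (n : ℕ) : 0 < lumpCoeff m 2 (n + 1) := by
  have h1 : 0 < lumpCoeff m 2 1 := by
    norm_num [lumpCoeff]
    linarith
  -- At r = 2, n = 0 the factor n + r - 2 kills the `lumpCoeff m 2 0` term.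
  have h2 : lumpCoeff m 2 2 = 5 * (1 + m) / 8 * lumpCoeff m 2 1 := by
    rw [lumpCoeff_add_two m 2 0]
    norm_num
    ring
  match n with
  | 0 => exact h1
  | n + 1 =>
    have := (lumpCoeff_pos_of_pos hm0 hm1 one_le_two (n := 0) (by rw [h2]; positivity)
      (by rw [h2]; nlinarith) n).1
    rwa [show n + 1 + 1 = 0 + n + 2 by ring]

/-- A ratio above m would freeze the sign of all later coefficients and so exclude a later zero. -/
theorem abs_lumpCoeff_le_of_eq_zero (hm0 : 0 < m) (hm1 : m < 1) (hr1 : 1 ≤ r) {n k : ℕ}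
    (h : lumpCoeff m r (n + k + 2) = 0) :
    |lumpCoeff m r (n + 2)| ≤ m * |lumpCoeff m r (n + 1)| := by
  rw [← abs_of_pos hm0, ← abs_mul, abs_of_pos hm0]
  rcases lt_trichotomy (lumpCoeff m r (n + 2)) 0 with hy | hy | hy
  · have : ¬ lumpCoeff m r (n + 2) ≤ m * lumpCoeff m r (n + 1) := fun hxy =>
      (lumpCoeff_neg_of_neg hm0 hm1 hr1 hy hxy k).1.ne h
    rw [abs_of_neg hy, abs_of_neg (by linarith)]
    linarith
  · rw [hy, abs_zero]
    exact abs_nonneg _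
  · have : ¬ m * lumpCoeff m r (n + 1) ≤ lumpCoeff m r (n + 2) := fun hxy =>
      (lumpCoeff_pos_of_pos hm0 hm1 hr1 hy hxy k).1.ne' h
    rw [abs_of_pos hy, abs_of_pos (by linarith)]
    linarith

/-- For a suitable exponent `r` the coefficients are a minimal solution of the recurrence. -/
theorem exists_lumpCoeff_le (hm0 : 0 < m) (hm1 : m < 1) :
    ∃ r : ℝ, 1 < r ∧ r ≤ 2 ∧
      ∀ n, |lumpCoeff m r (n + 2)| ≤ m * |lumpCoeff m r (n + 1)| := by
  -- The first N ratio bounds cut out nested compact subsets of [1, 2].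
  let S : ℕ → Set ℝ := fun N => ⋂ n, {r | r ∈ Set.Icc (1 : ℝ) 2 ∧
    (n < N → |lumpCoeff m r (n + 2)| ≤ m * |lumpCoeff m r (n + 1)|)}
  have hclosed : ∀ N, IsClosed (S N) := by
    refine fun N => isClosed_iInter fun n => ?_
    by_cases hn : n < N
    · simp only [hn, true_imp_iff]
      exact isClosed_Icc.isClosed_le (continuousOn_lumpCoeff m (n + 2)).abs
        (continuousOn_const.mul (continuousOn_lumpCoeff m (n + 1)).abs)
    · simp only [hn, false_imp_iff, and_true]
      exact isClosed_Icc
  have hne : ∀ N, (S N).Nonempty := by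
    intro N
    obtain ⟨r, hr, h0⟩ := intermediate_value_Icc one_le_two (continuousOn_lumpCoeff m (N + 1))
      ⟨(lumpCoeff_one_neg hm0 hm1 N).le, (lumpCoeff_two_pos hm0 hm1 N).le⟩
    refine ⟨r, Set.mem_iInter.2 fun n => ⟨hr, fun hn => ?_⟩⟩
    obtain ⟨k, rfl⟩ := Nat.exists_eq_add_of_lt hn
    exact abs_lumpCoeff_le_of_eq_zero hm0 hm1 hr.1 h0
  have hmem : ∀ {N r}, r ∈ S N → ∀ n, r ∈ Set.Icc (1 : ℝ) 2 ∧
      (n < N → |lumpCoeff m r (n + 2)| ≤ m * |lumpCoeff m r (n + 1)|) :=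
    fun hr => Set.mem_iInter.1 hr
  obtain ⟨r, hr⟩ := IsCompact.nonempty_iInter_of_sequence_nonempty_isCompact_isClosed S
    (fun N r hr => Set.mem_iInter.2 fun n =>
      ⟨(hmem hr n).1, fun hn => (hmem hr n).2 (Nat.lt_succ_of_lt hn)⟩) hne
    (isCompact_Icc.of_isClosed_subset (hclosed 0) fun r hr => (hmem hr 0).1) hclosed
  rw [Set.mem_iInter] at hr
  have hle : ∀ n, |lumpCoeff m r (n + 2)| ≤ m * |lumpCoeff m r (n + 1)| := fun n =>
    (hmem (hr (n + 1)) n).2 (Nat.lt_succ_self n)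
  have hr12 := (hmem (hr 0) 0).1
  refine ⟨r, lt_of_le_of_ne hr12.1 ?_, hr12.2, hle⟩
  -- At r = 1 the ratio of the third to the second coefficient is (1 + m)/2 > m.
  rintro rfl
  have h3 := hle 1
  have h2 := lumpCoeff_one_neg hm0 hm1 1
  have h2' := abs_pos.2 h2.ne
  rw [lumpCoeff_one_three, abs_mul, abs_of_pos (by linarith)] at h3
  nlinarith

theorem exists_abs_lumpCoeff_le (hm0 : 0 < m)
    (h : ∀ n, |lumpCoeff m r (n + 2)| ≤ m * |lumpCoeff m r (n + 1)|) :
    ∃ C, ∀ n, |lumpCoeff m r n| ≤ C * m ^ n := by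
  have h1 : ∀ n, |lumpCoeff m r (n + 1)| ≤ |lumpCoeff m r 1| * m ^ n := by
    intro n
    induction n with
    | zero => simp
    | succ n ih =>
      calc _ ≤ m * |lumpCoeff m r (n + 1)| := h n
        _ ≤ m * (|lumpCoeff m r 1| * m ^ n) := by gcongr
        _ = _ := by ring
  refine ⟨1 + |lumpCoeff m r 1| / m, fun n => ?_⟩
  match n with
  | 0 => simp [lumpCoeff]; positivity
  | n + 1 =>
    refine (h1 n).trans ?_
    have : |lumpCoeff m r 1| * m ^ n = |lumpCoeff m r 1| / m * m ^ (n + 1) := by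
      field_simp
      ring
    rw [this]
    gcongr
    linarith

end

/-! ### Summing the series and the equation for G -/

section PowerSeries

variable {c : ℕ → ℂ} {C m : ℝ} {k : ℕ} {w : ℂ}

/-- The factor n^k makes the class of bounds stable under the Euler operator w d/dw, which
multiplies the n-th coefficient by n. -/
theorem summable_of_norm_le_pow_mul_geometric (hm : 0 < m)
    (hc : ∀ n, ‖c n‖ ≤ C * (n ^ k * m ^ n)) (hw : ‖w‖ < 1 / m) :
    Summable fun n => c n * w ^ n := by
  have h1 : ‖m * ‖w‖‖ < 1 := by
    rw [norm_mul, norm_norm, Real.norm_of_nonneg hm.le, mul_comm]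
    exact (lt_div_iff₀ hm).1 hw
  refine Summable.of_norm_bounded ((summable_pow_mul_geometric_of_norm_lt_one k h1).mul_left C)
    fun n => ?_
  rw [norm_mul, norm_pow, mul_pow, ← mul_assoc (n ^ k : ℝ), ← mul_assoc]
  exact mul_le_mul_of_nonneg_right (hc n) (by positivity)

theorem hasDerivAt_tsum_of_norm_le_pow_mul_geometric (hm : 0 < m)
    (hc : ∀ n, ‖c n‖ ≤ C * (n ^ k * m ^ n)) (hw : ‖w‖ < 1 / m) :
    HasDerivAt (fun w => ∑' n, c n * w ^ n) (∑' n, c n * (n * w ^ (n - 1))) w := by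
  obtain ⟨ρ, hwρ, hρ⟩ := exists_between hw
  have hρ0 : 0 < ρ := (norm_nonneg w).trans_lt hwρ
  have h1 : ‖m * ρ‖ < 1 := by
    rw [Real.norm_of_nonneg (by positivity), mul_comm]
    exact (lt_div_iff₀ hm).1 hρ
  refine hasDerivAt_tsum_of_isPreconnected
    (u := fun n : ℕ => C / ρ * ((n : ℝ) ^ (k + 1) * (m * ρ) ^ n)) (t := Metric.ball 0 ρ) (y₀ := 0)
    ((summable_pow_mul_geometric_of_norm_lt_one (k + 1) h1).mul_left _) Metric.isOpen_ball
    (convex_ball _ _).isPreconnected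
    (fun n y _ => (hasDerivAt_pow n y).const_mul (c n)) (fun n y hy => ?_)
    (by simpa using hρ0) ?_ (by simpa using hwρ)
  · rw [mem_ball_zero_iff] at hy
    rcases n.eq_zero_or_pos with rfl | hn
    · simp
    · have : ρ ^ n = ρ ^ (n - 1) * ρ := by rw [← pow_succ, Nat.sub_add_cancel hn]
      calc ‖c n * (n * y ^ (n - 1))‖ = ‖c n‖ * (n * ‖y‖ ^ (n - 1)) := by simp
        _ ≤ (C * (n ^ k * m ^ n)) * (n * ρ ^ (n - 1)) := by
            gcongr
            · exact (norm_nonneg _).trans (hc n)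
            · exact hc n
        _ = C / ρ * ((n : ℝ) ^ (k + 1) * (m * ρ) ^ n) := by
            rw [mul_pow, this]
            field_simp
            ring
  · exact summable_of_norm_le_pow_mul_geometric hm hc (by simpa using hm)

theorem mul_deriv_tsum_of_norm_le_pow_mul_geometric (hm : 0 < m)
    (hc : ∀ n, ‖c n‖ ≤ C * (n ^ k * m ^ n)) (hw : ‖w‖ < 1 / m) :
    w * deriv (fun w => ∑' n, c n * w ^ n) w = ∑' n, (n * c n) * w ^ n := by
  rw [(hasDerivAt_tsum_of_norm_le_pow_mul_geometric hm hc hw).deriv, ← tsum_mul_left]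
  refine tsum_congr fun n => ?_
  rcases n.eq_zero_or_pos with rfl | hn
  · simp
  · have : w ^ n = w ^ (n - 1) * w := by rw [← pow_succ, Nat.sub_add_cancel hn]
    rw [this]
    ring

end PowerSeries

/-- `G` satisfies the equation at `w` that `-η'' + U η = (4 - 4 r²) η` becomes under
`η = w ^ r * G w`, with `w` the normalized lump and `m = tanh² a`. -/
def LumpEquationAt (m r : ℂ) (G : ℂ → ℂ) (w : ℂ) : Prop :=
  4 * (w * deriv (deriv G) w + (1 + 2 * r) * deriv G w)
    - 2 * (1 + m) * (2 * (w ^ 2 * deriv (deriv G) w + w * deriv G w)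
      + (4 * r + 1) * (w * deriv G w) + (2 * r - 3) * (r + 2) * G w)
    + 4 * m * w * (w ^ 2 * deriv (deriv G) w + w * deriv G w
      + (2 * r + 1) * (w * deriv G w) + (r + 3) * (r - 2) * G w) = 0

theorem exists_analytic_lumpEquation {m r : ℝ} (hm0 : 0 < m) (hr : 0 < r)
    (h : ∃ C, ∀ n, |lumpCoeff m r n| ≤ C * m ^ n) :
    ∃ G : ℂ → ℂ, AnalyticOnNhd ℂ G (Metric.ball 0 (1 / m)) ∧ G 0 = 1 ∧
      ∀ w ∈ Metric.ball (0 : ℂ) (1 / m), LumpEquationAt m r G w := by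
  obtain ⟨C, hC⟩ := h
  let c : ℕ → ℂ := fun n => (lumpCoeff m r n : ℂ)
  let G : ℂ → ℂ := fun w => ∑' n, c n * w ^ n
  let G₁ : ℂ → ℂ := fun w => ∑' n, (n * c n) * w ^ n
  let G₂ : ℂ → ℂ := fun w => ∑' n, (n * (n * c n)) * w ^ n
  have hc0 : ∀ n, ‖c n‖ ≤ C * (n ^ 0 * m ^ n) := fun n => by simpa [c] using hC n
  have hc1 : ∀ n, ‖n * c n‖ ≤ C * (n ^ 1 * m ^ n) := fun n => by
    rw [norm_mul, Complex.norm_natCast, mul_left_comm, pow_one]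
    exact mul_le_mul_of_nonneg_left (by simpa [c] using hC n) n.cast_nonneg
  have hc2 : ∀ n, ‖n * (n * c n)‖ ≤ C * (n ^ 2 * m ^ n) := fun n => by
    rw [norm_mul, Complex.norm_natCast, pow_two, mul_assoc (n : ℝ), mul_left_comm C]
    exact mul_le_mul_of_nonneg_left (by simpa using hc1 n) n.cast_nonneg
  have hG : AnalyticOnNhd ℂ G (Metric.ball 0 (1 / m)) := by
    refine DifferentiableOn.analyticOnNhd (fun w hw => ?_) Metric.isOpen_ball
    exact (hasDerivAt_tsum_of_norm_le_pow_mul_geometric hm0 hc0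
      (by simpa using hw)).differentiableAt.differentiableWithinAt
  have hG0 : G 0 = 1 := by
    have : G 0 = c 0 * 0 ^ 0 := tsum_eq_single 0 fun n hn => by simp [hn]
    rw [this]
    simp [c, lumpCoeff]
  have hmul : ∀ w ∈ Metric.ball (0 : ℂ) (1 / m), w * deriv G w = G₁ w := fun w hw =>
    mul_deriv_tsum_of_norm_le_pow_mul_geometric hm0 hc0 (by simpa using hw)
  have hmul2 : ∀ w ∈ Metric.ball (0 : ℂ) (1 / m),
      w ^ 2 * deriv (deriv G) w + w * deriv G w = G₂ w := fun w hw => by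
    have h1 : w * deriv G₁ w = G₂ w :=
      mul_deriv_tsum_of_norm_le_pow_mul_geometric hm0 hc1 (by simpa using hw)
    have h2 : G₁ =ᶠ[𝓝 w] fun w => w * deriv G w := by
      filter_upwards [Metric.isOpen_ball.mem_nhds hw] with v hv using (hmul v hv).symm
    have h3 : HasDerivAt (fun w => w * deriv G w) (1 * deriv G w + w * deriv (deriv G) w) w :=
      (hasDerivAt_id' w).mul (hG.deriv w hw).differentiableAt.hasDerivAt
    rw [← h1, h2.deriv_eq, h3.deriv]
    ring
  have hr1 : (1 + 2 * r : ℂ) ≠ 0 := by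
    exact_mod_cast (by positivity : (1 + 2 * r : ℝ) ≠ 0)
  have hc1v : c 1 * (2 * (1 + 2 * r)) = (1 + m) * (2 * r - 3) * (r + 2) := by
    simp only [c, lumpCoeff]
    push_cast
    rw [div_mul_cancel₀]
    exact mul_ne_zero two_ne_zero hr1
  have hc0v : c 0 = 1 := by simp [c, lumpCoeff]
  -- This is `LumpEquationAt` times w, written with Euler operators so that it acts diagonally on
  -- monomials.
  have hE : ∀ w ∈ Metric.ball (0 : ℂ) (1 / m),
      4 * (G₂ w + 2 * r * G₁ w)
        - 2 * (1 + m) * w * (2 * G₂ w + (4 * r + 1) * G₁ w + (2 * r - 3) * (r + 2) * G w)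
        + 4 * m * w ^ 2 * (G₂ w + (2 * r + 1) * G₁ w + (r + 3) * (r - 2) * G w) = 0 := by
    intro w hw
    have hw' : ‖w‖ < 1 / m := by simpa using hw
    have s0 : HasSum (fun n => c n * w ^ n) (G w) :=
      (summable_of_norm_le_pow_mul_geometric hm0 hc0 hw').hasSum
    have s1 : HasSum (fun n => (n * c n) * w ^ n) (G₁ w) :=
      (summable_of_norm_le_pow_mul_geometric hm0 hc1 hw').hasSum
    have s2 : HasSum (fun n => (n * (n * c n)) * w ^ n) (G₂ w) :=
      (summable_of_norm_le_pow_mul_geometric hm0 hc2 hw').hasSum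
    have sA := (s2.add (s1.mul_left (2 * r : ℂ))).mul_left 4
    have sB := (((s2.mul_left 2).add (s1.mul_left (4 * r + 1 : ℂ))).add
      (s0.mul_left ((2 * r - 3) * (r + 2) : ℂ))).mul_left (2 * (1 + m) * w : ℂ)
    have sC := ((s2.add (s1.mul_left (2 * r + 1 : ℂ))).add
      (s0.mul_left ((r + 3) * (r - 2) : ℂ))).mul_left (4 * m * w ^ 2 : ℂ)
    -- The shifts align the three series at w^(n+2); the split-off low-order terms cancel by the
    -- values of c 0 and c 1.
    rw [← hasSum_nat_add_iff' 2] at sA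
    rw [← hasSum_nat_add_iff' 1] at sB
    have s := (sA.sub sB).add sC
    have h0 := s.tsum_eq.symm.trans ((tsum_congr (g := fun _ => (0 : ℂ)) fun n => by
      have hn : (n + 2 : ℂ) * (n + 2 + 2 * r) ≠ 0 := by
        exact_mod_cast (by positivity : ((n + 2) * (n + 2 + 2 * r) : ℝ) ≠ 0)
      have hrec : c (n + 2) * ((n + 2) * (n + 2 + 2 * r)) =
          (1 + m) * (n + r - 1 / 2) * (n + r + 3) * c (n + 1)
            - m * (n + r + 3) * (n + r - 2) * c n := by
        simp only [c, lumpCoeff_add_two]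
        push_cast
        rw [div_mul_cancel₀ _ hn]
      push_cast
      linear_combination (4 * w ^ (n + 2)) * hrec).trans tsum_zero)
    simp only [Finset.sum_range_succ, Finset.sum_range_zero, hc0v] at h0
    push_cast at h0
    linear_combination h0 + 2 * w * hc1v
  refine ⟨G, hG, hG0, fun w hw => ?_⟩
  -- Division by w fails at 0, where the equation is just the formula for c 1.
  rcases eq_or_ne w 0 with rfl | h0
  · have hd : deriv G 0 = c 1 := by
      rw [(hasDerivAt_tsum_of_norm_le_pow_mul_geometric hm0 hc0 (by simpa using hm0)).deriv]
      refine (tsum_eq_single 1 fun n hn => ?_).trans (by simp)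
      rcases n with _ | _ | n
      · simp
      · simp at hn
      · simp
    simp only [LumpEquationAt, hG0, hd]
    linear_combination 2 * hc1v
  · refine mul_left_cancel₀ h0 ?_
    have := hE w hw
    rw [← hmul2 w hw, ← hmul w hw] at this
    linear_combination this

/-! ### Positivity by Sturm comparison -/

section

variable {m r : ℝ} {G : ℂ → ℂ}

theorem ofReal_mem_ball_one_div (hm0 : 0 < m) (hm1 : m < 1) {x : ℝ} (hx : x ∈ Set.Icc (0 : ℝ) 1) :
    (x : ℂ) ∈ Metric.ball (0 : ℂ) (1 / m) := by
  rw [mem_ball_zero_iff, Complex.norm_real, Real.norm_of_nonneg hx.1]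
  exact hx.2.trans_lt ((one_lt_div hm0).2 hm1)

/-- The coefficients are real, so Re G solves the real equation on the axis; G itself need not be
shown real. -/
theorem re_lumpEquation {x : ℝ} (h : LumpEquationAt m r G x) :
    4 * (x * (deriv (deriv G) x).re + (1 + 2 * r) * (deriv G x).re)
      - 2 * (1 + m) * (2 * (x ^ 2 * (deriv (deriv G) x).re + x * (deriv G x).re)
        + (4 * r + 1) * (x * (deriv G x).re) + (2 * r - 3) * (r + 2) * (G x).re)
      + 4 * m * x * (x ^ 2 * (deriv (deriv G) x).re + x * (deriv G x).re
        + (2 * r + 1) * (x * (deriv G x).re) + (r + 3) * (r - 2) * (G x).re) = 0 := by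
  have := congrArg Complex.re h
  have e : ∀ (a : ℝ) (z : ℂ), ((a : ℂ) * z).re = a * z.re := fun a z => by simp
  rw [← Complex.zero_re, ← this]
  have h1 := e (4 * x - 4 * (1 + m) * x ^ 2 + 4 * m * x * x ^ 2) (deriv (deriv G) x)
  have h2 := e (4 * (1 + 2 * r) - 2 * (1 + m) * (2 * x + (4 * r + 1) * x)
    + 4 * m * x * (x + (2 * r + 1) * x)) (deriv G x)
  have h3 := e (-2 * (1 + m) * ((2 * r - 3) * (r + 2)) + 4 * m * x * ((r + 3) * (r - 2))) (G x)
  have h4 := congrArg₂ (· + ·) (congrArg₂ (· + ·) h1 h2) h3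
  simp only [← Complex.add_re] at h4
  refine Eq.trans ?_ (h4.symm.trans (congrArg Complex.re ?_))
  · ring
  · push_cast
    ring

theorem HasDerivAt.nonpos_of_forall_lt {g : ℝ → ℝ} {g' b ε : ℝ} (h : HasDerivAt g g' b)
    (hε : ε < b) (hg : ∀ x ∈ Set.Ioo ε b, g b ≤ g x) : g' ≤ 0 := by
  have h1 : Tendsto (slope g b) (𝓝[<] b) (𝓝 g') :=
    (hasDerivAt_iff_tendsto_slope.1 h).mono_left (nhdsWithin_mono _ fun x hx => ne_of_lt hx)
  refine le_of_tendsto h1 ?_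
  filter_upwards [Ioo_mem_nhdsLT hε] with x hx
  rw [slope_def_field]
  exact div_nonpos_of_nonneg_of_nonpos (sub_nonneg.2 (hg x hx)) (sub_nonpos.2 hx.2.le)

/-- For eigenvalue parameters below the zero mode (`1 < r`), the solution decaying at infinity has
no zero: it is compared with the zero mode `w * √((1 - w) * (1 - m * w))`. -/
theorem re_pos_of_lumpEquation (hm0 : 0 < m) (hm1 : m < 1) (hr : 1 < r)
    (hG : AnalyticOnNhd ℂ G (Metric.ball 0 (1 / m))) (hG0 : G 0 = 1)
    (hE : ∀ w ∈ Metric.ball (0 : ℂ) (1 / m), LumpEquationAt m r G w)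
    {x : ℝ} (hx : x ∈ Set.Icc (0 : ℝ) 1) : 0 < (G x).re := by
  have hball := fun {x : ℝ} => ofReal_mem_ball_one_div (x := x) hm0 hm1
  have d0 : ∀ x ∈ Set.Icc (0 : ℝ) 1, HasDerivAt (fun x : ℝ => (G x).re) (deriv G x).re x :=
    fun x hx => (hG x (hball hx)).differentiableAt.hasDerivAt.real_of_complex
  have d1 : ∀ x ∈ Set.Icc (0 : ℝ) 1,
      HasDerivAt (fun x : ℝ => (deriv G x).re) (deriv (deriv G) x).re x :=
    fun x hx => (hG.deriv x (hball hx)).differentiableAt.hasDerivAt.real_of_complex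
  by_contra hneg
  push Not at hneg
  have hcont : ContinuousOn (fun x : ℝ => (G x).re) (Set.Icc 0 1) :=
    fun x hx => (d0 x hx).continuousAt.continuousWithinAt
  -- b is the first zero of Re G.
  obtain ⟨b, ⟨hb, hgb⟩, hmin⟩ : ∃ b, IsLeast {x | x ∈ Set.Icc (0 : ℝ) 1 ∧ (G x).re ≤ 0} b :=
    (isCompact_Icc.of_isClosed_subset (isClosed_Icc.isClosed_le hcont continuousOn_const)
      fun x hx => hx.1).exists_isLeast ⟨x, hx, hneg⟩
  have hb0 : 0 < b := by
    refine lt_of_le_of_ne hb.1 ?_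
    rintro rfl
    simp [hG0] at hgb
    linarith
  have hpos : ∀ y ∈ Set.Ico 0 b, 0 < (G y).re := fun y hy => by
    by_contra hy'
    exact (hmin ⟨⟨hy.1, hy.2.le.trans hb.2⟩, not_lt.1 hy'⟩).not_gt hy.2
  have hgb0 : (G b).re = 0 := by
    refine le_antisymm hgb ?_
    refine ge_of_tendsto ((d0 b hb).continuousAt.tendsto.mono_left nhdsWithin_le_nhds)
      (?_ : ∀ᶠ y : ℝ in 𝓝[<] b, 0 ≤ (G y).re)
    filter_upwards [Ioo_mem_nhdsLT hb0] with y hy using (hpos y ⟨hy.1.le, hy.2⟩).le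
  have hd : (deriv G b).re ≤ 0 := (d0 b hb).nonpos_of_forall_lt hb0 fun y hy => by
    rw [hgb0]
    exact (hpos y ⟨hy.1.le, hy.2⟩).le
  -- Up to a constant factor, the x-Wronskian of the mode with the zero mode, in the variable w. Its
  -- derivative is (r² - 1) w^r Re G, positive before b.
  let Y : ℝ → ℝ := fun x => x ^ (r + 1) *
    (((r - 1) * (G x).re + x * (deriv G x).re) * ((1 - x) * (1 - m * x))
      - x * (G x).re * (-(1 + m) + 2 * m * x) / 2)
  have hsub : Set.Icc 0 b ⊆ Set.Icc (0 : ℝ) 1 := Set.Icc_subset_Icc_right hb.2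
  have hY : StrictMonoOn Y (Set.Icc 0 b) := by
    refine strictMonoOn_of_deriv_pos (convex_Icc _ _) ?_ fun x hx => ?_
    · intro x hx
      have c0 := (d0 x (hsub hx)).continuousAt
      have c1 := (d1 x (hsub hx)).continuousAt
      have c2 : ContinuousAt (fun x : ℝ => x ^ (r + 1)) x :=
        (Real.continuous_rpow_const (by linarith)).continuousAt
      exact ContinuousAt.continuousWithinAt (by fun_prop)
    · rw [interior_Icc] at hx
      have hx1 : x ∈ Set.Icc (0 : ℝ) 1 := hsub (Set.Ioo_subset_Icc_self hx)
      have e0 := d0 x hx1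
      have e1 := d1 x hx1
      have i := hasDerivAt_id' x
      have e2 : HasDerivAt (fun x : ℝ => x ^ (r + 1)) ((r + 1) * x ^ r) x := by
        simpa using Real.hasDerivAt_rpow_const (p := r + 1) (Or.inl hx.1.ne')
      have e3 := e2.mul ((((e0.const_mul (r - 1)).add (i.mul e1)).mul
        ((i.const_sub 1).mul ((i.const_mul m).const_sub 1))).sub
        (((i.mul e0).mul ((i.const_mul (2 * m)).const_add (-(1 + m)))).div_const 2))
      have hode := re_lumpEquation (hE x (hball hx1))
      have hpow : x ^ (r + 1) = x ^ r * x := by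
        rw [Real.rpow_add hx.1, Real.rpow_one]
      have hdY : HasDerivAt Y ((r ^ 2 - 1) * x ^ r * (G x).re) x := by
        refine e3.congr_deriv ?_
        simp only [Pi.mul_apply, Pi.add_apply, Pi.sub_apply]
        rw [hpow]
        linear_combination (x ^ r * x / 4) * hode
      rw [hdY.deriv]
      exact mul_pos (mul_pos (by nlinarith) (Real.rpow_pos_of_pos hx.1 r))
        (hpos x ⟨hx.1.le, hx.2⟩)
  have h1 := hY (Set.left_mem_Icc.2 hb0.le) (Set.right_mem_Icc.2 hb0.le) hb0
  have h2 : Y 0 = 0 := by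
    simp only [Y, Real.zero_rpow (by linarith : r + 1 ≠ 0), zero_mul]
  -- At b only the term with G'(b) ≤ 0 survives. If b = 1, the factor 1 - b makes it vanish, which
  -- still contradicts strict growth from Y 0 = 0.
  have h3 : Y b ≤ 0 := by
    simp only [Y, hgb0]
    have : 0 ≤ (1 - b) * (1 - m * b) :=
      mul_nonneg (sub_nonneg.2 hb.2) (sub_nonneg.2 (by nlinarith [hb.2]))
    have h4 : 0 ≤ b ^ (r + 1) * (b * ((1 - b) * (1 - m * b))) :=
      mul_nonneg (Real.rpow_nonneg hb0.le _) (mul_nonneg hb0.le this)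
    nlinarith [mul_nonneg h4 (neg_nonneg.2 hd)]
  linarith

end

/-! ### Lower bound on the spectrum -/

/-- If F x₀ > 0, integrating the inequality once, with ∫ y finite, makes y grow at least linearly to
the right of x₀, contradicting integrability. With y = η² this replaces any decay estimate for η'.
-/
theorem nonpos_of_integrable_of_le_deriv {y y' F : ℝ → ℝ} {K : ℝ} (hK : 0 ≤ K)
    (hint : Integrable y) (hy0 : ∀ x, 0 ≤ y x) (hy : ∀ x, HasDerivAt y (y' x) x)
    (hF : Monotone F) (hle : ∀ x, 2 * F x - 2 * K * y x ≤ y' x) (x₀ : ℝ) : F x₀ ≤ 0 := by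
  by_contra! hc
  set M := ∫ x, y x with hM
  have hM0 : 0 ≤ M := integral_nonneg hy0
  have hcont : Continuous y := continuous_iff_continuousAt.2 fun x => (hy x).continuousAt
  let Y : ℝ → ℝ := fun X => ∫ x in x₀..X, y x
  have hY : ∀ X, HasDerivAt Y (y X) X := fun X =>
    intervalIntegral.integral_hasDerivAt_right (hcont.intervalIntegrable _ _)
      hcont.stronglyMeasurable.stronglyMeasurableAtFilter hcont.continuousAt
  have hYM : ∀ X, x₀ ≤ X → Y X ≤ M := fun X hX => by
    simp only [Y, intervalIntegral.integral_of_le hX]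
    exact setIntegral_le_integral hint (Eventually.of_forall hy0)
  have hmono1 : MonotoneOn (fun x => y x + 2 * K * Y x - 2 * F x₀ * x) (Set.Ici x₀) := by
    have hd : ∀ x, HasDerivAt (fun x => y x + 2 * K * Y x - 2 * F x₀ * x)
        (y' x + 2 * K * y x - 2 * F x₀ * 1) x := fun x =>
      ((hy x).add ((hY x).const_mul _)).sub ((hasDerivAt_id' x).const_mul _)
    refine monotoneOn_of_deriv_nonneg (convex_Ici _)
      (fun x _ => (hd x).continuousAt.continuousWithinAt)
      (fun x _ => (hd x).differentiableAt.differentiableWithinAt) fun x hx => ?_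
    rw [interior_Ici] at hx
    rw [(hd x).deriv]
    linarith [hle x, hF (le_of_lt hx)]
  have hlow : ∀ X, x₀ ≤ X → 2 * F x₀ * (X - x₀) - 2 * K * M ≤ y X := fun X hX => by
    have h1 := hmono1 (Set.mem_Ici.2 le_rfl) (Set.mem_Ici.2 hX) hX
    have h2 : Y x₀ = 0 := intervalIntegral.integral_same
    simp only [h2] at h1
    have h3 := mul_le_mul_of_nonneg_left (hYM X hX) (by linarith : 0 ≤ 2 * K)
    linarith [hy0 x₀]
  have hmono2 : MonotoneOn (fun x => Y x - F x₀ * (x - x₀) ^ 2 + 2 * K * M * x) (Set.Ici x₀) := by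
    have hd : ∀ x, HasDerivAt (fun x => Y x - F x₀ * (x - x₀) ^ 2 + 2 * K * M * x)
        (y x - F x₀ * ((2 : ℕ) * (x - x₀) ^ (2 - 1) * 1) + 2 * K * M * 1) x := fun x =>
      ((hY x).sub ((((hasDerivAt_id' x).sub_const x₀).pow 2).const_mul _)).add
        ((hasDerivAt_id' x).const_mul _)
    refine monotoneOn_of_deriv_nonneg (convex_Ici _)
      (fun x _ => (hd x).continuousAt.continuousWithinAt)
      (fun x _ => (hd x).differentiableAt.differentiableWithinAt) fun x hx => ?_
    rw [interior_Ici] at hx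
    rw [(hd x).deriv]
    have := hlow x (le_of_lt hx)
    norm_num
    linarith
  -- Chosen so that F x₀ T² - 2 K M T = (M + 1 + F x₀) T exceeds M.
  set T := (2 * K * M + M + 1) / F x₀ + 1 with hT
  have hT1 : 1 ≤ T := by
    have : 0 ≤ (2 * K * M + M + 1) / F x₀ := by positivity
    linarith
  have hTF : F x₀ * T = 2 * K * M + M + 1 + F x₀ := by
    rw [hT]
    field_simp
  have h1 := hmono2 (Set.mem_Ici.2 le_rfl) (Set.mem_Ici.2 (by linarith : x₀ ≤ x₀ + T))
    (by linarith)
  have h2 : Y x₀ = 0 := intervalIntegral.integral_same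
  simp only [h2] at h1
  have h3 := hYM (x₀ + T) (by linarith)
  have h4 : F x₀ * (x₀ + T - x₀) ^ 2 = (2 * K * M + M + 1 + F x₀) * T := by
    rw [← hTF]
    ring
  rw [h4] at h1
  nlinarith

/-- A positive solution with bounded logarithmic derivative bounds the spectrum from below. -/
theorem le_of_pos_solution {U η₀ η₀' η η' : ℝ → ℝ} {l₀ l K : ℝ}
    (hpos : ∀ x, 0 < η₀ x) (h₀ : ∀ x, HasDerivAt η₀ (η₀' x) x)
    (h₀' : ∀ x, HasDerivAt η₀' ((U x - l₀) * η₀ x) x) (hK : ∀ x, |η₀' x| ≤ K * η₀ x)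
    (h : ∀ x, HasDerivAt η (η' x) x) (h' : ∀ x, HasDerivAt η' ((U x - l) * η x) x)
    (hint : Integrable fun x => η x ^ 2) (hne : η ≠ 0) : l₀ ≤ l := by
  by_contra! hlt
  have hK0 : 0 ≤ K := by
    by_contra! hK0
    nlinarith [(abs_nonneg _).trans (hK 0), hpos 0]
  let v : ℝ → ℝ := fun x => η₀' x / η₀ x
  have hv : ∀ x, |v x| ≤ K := fun x => by
    rw [abs_div, abs_of_pos (hpos x), div_le_iff₀ (hpos x)]
    exact hK x
  -- Picone's identity: by the Riccati equation for v, F' = (η' - v η)² + (l₀ - l) η², so F is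
  -- monotone when l < l₀.
  let F : ℝ → ℝ := fun x => η x * η' x - v x * η x ^ 2
  have hF : ∀ x, HasDerivAt F ((η' x - v x * η x) ^ 2 + (l₀ - l) * η x ^ 2) x := fun x => by
    have hne0 := (hpos x).ne'
    refine (((h x).mul (h' x)).sub (((h₀' x).div (h₀ x) hne0).mul ((h x).pow 2))).congr_deriv ?_
    simp only [v, Pi.div_apply, Pi.pow_apply]
    field_simp
    ring
  have hmono : Monotone F := by
    refine monotone_of_deriv_nonneg (fun x => (hF x).differentiableAt) fun x => ?_
    rw [(hF x).deriv]
    have := mul_nonneg (sub_nonneg.2 hlt.le) (sq_nonneg (η x))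
    positivity
  have hy : ∀ x, HasDerivAt (fun x => η x ^ 2) (2 * F x + 2 * v x * η x ^ 2) x := fun x => by
    refine ((h x).pow 2).congr_deriv ?_
    simp only [F]
    push_cast
    ring
  have hvb : ∀ x, |2 * v x * η x ^ 2| ≤ 2 * K * η x ^ 2 := fun x => by
    rw [abs_mul, abs_mul, abs_two, abs_of_nonneg (sq_nonneg (η x))]
    have := hv x
    gcongr
  have hle : ∀ x, F x ≤ 0 := nonpos_of_integrable_of_le_deriv hK0 hint (fun x => sq_nonneg _) hy
    hmono fun x => by linarith [neg_le_of_abs_le (hvb x)]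
  -- Reflecting x gives the opposite sign, so F vanishes identically, and F' = 0 forces η = 0.
  have hge : ∀ x, -F (-x) ≤ 0 := by
    refine nonpos_of_integrable_of_le_deriv (y := fun x => η (-x) ^ 2)
      (y' := fun x => -(2 * F (-x) + 2 * v (-x) * η (-x) ^ 2)) (F := fun x => -F (-x)) hK0
      hint.comp_neg (fun x => sq_nonneg _) (fun x => ?_)
      (fun x z hxz => neg_le_neg (hmono (neg_le_neg hxz))) fun x => ?_
    · exact ((hy (-x)).comp x (hasDerivAt_neg x)).congr_deriv (by ring)
    · linarith [le_of_abs_le (hvb (-x))]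
  have hF0 : F = fun _ => 0 := funext fun x =>
    le_antisymm (hle x) (by have := hge (-x); rw [neg_neg] at this; linarith)
  refine hne (funext fun x => ?_)
  have h1 := hF x
  rw [hF0] at h1
  have h2 := h1.unique (hasDerivAt_const x 0)
  have h3 := sq_nonneg (η' x - v x * η x)
  have h4 : η x ^ 2 ≤ 0 := by nlinarith
  simpa using h4

/-! ### Calculus of the lump -/

/-- The lump divided by its maximum. -/
noncomputable def normalizedLump (a x : ℝ) : ℝ :=
  Real.cosh a ^ 2 / (Real.cosh x ^ 2 + Real.sinh a ^ 2)

/-- The logarithmic derivative of the lump. -/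
noncomputable def lumpLogDeriv (a x : ℝ) : ℝ :=
  -(2 * Real.cosh x * Real.sinh x) / (Real.cosh x ^ 2 + Real.sinh a ^ 2)

section

variable (a x : ℝ)

theorem cosh_sq_add_sinh_sq_pos : 0 < Real.cosh x ^ 2 + Real.sinh a ^ 2 :=
  add_pos_of_pos_of_nonneg (pow_pos (Real.cosh_pos x) 2) (sq_nonneg _)

theorem normalizedLump_pos : 0 < normalizedLump a x :=
  div_pos (pow_pos (Real.cosh_pos a) 2) (cosh_sq_add_sinh_sq_pos a x)

theorem normalizedLump_le_one : normalizedLump a x ≤ 1 := by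
  rw [normalizedLump, div_le_one (cosh_sq_add_sinh_sq_pos a x), Real.cosh_sq a]
  nlinarith [Real.one_le_cosh x]

theorem normalizedLump_mem_Icc : normalizedLump a x ∈ Set.Icc (0 : ℝ) 1 :=
  ⟨(normalizedLump_pos a x).le, normalizedLump_le_one a x⟩

theorem normalizedLump_le : normalizedLump a x ≤ Real.cosh a ^ 2 * (1 + x ^ 2)⁻¹ := by
  rw [normalizedLump, div_eq_mul_inv]
  refine mul_le_mul_of_nonneg_left (inv_anti₀ (by positivity) ?_) (sq_nonneg _)
  have h1 : x ^ 2 ≤ Real.sinh x ^ 2 := sq_le_sq.2 (by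
    rw [Real.abs_sinh]
    exact Real.self_le_sinh_iff.2 (abs_nonneg x))
  rw [Real.cosh_sq]
  nlinarith [sq_nonneg (Real.sinh a)]

theorem hasDerivAt_normalizedLump :
    HasDerivAt (normalizedLump a) (lumpLogDeriv a x * normalizedLump a x) x := by
  have hD := (cosh_sq_add_sinh_sq_pos a x).ne'
  have h : HasDerivAt (normalizedLump a) _ x := ((hasDerivAt_const x (Real.cosh a ^ 2)).div
    (((Real.hasDerivAt_cosh x).pow 2).add_const (Real.sinh a ^ 2)) hD)
  refine h.congr_deriv ?_
  simp only [lumpLogDeriv, normalizedLump]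
  field_simp
  ring

/-- The first integral φ'² = 2 V(φ) of the static equation. It makes the change of variable to w
algebraic. -/
theorem lumpLogDeriv_sq : lumpLogDeriv a x ^ 2 =
    4 * (1 - normalizedLump a x) * (1 - Real.tanh a ^ 2 * normalizedLump a x) := by
  have hD := (cosh_sq_add_sinh_sq_pos a x).ne'
  have hc : Real.cosh a ≠ 0 := (Real.cosh_pos a).ne'
  have h1 : 1 - normalizedLump a x =
      Real.sinh x ^ 2 / (Real.cosh x ^ 2 + Real.sinh a ^ 2) := by
    rw [normalizedLump, eq_div_iff hD, sub_mul, div_mul_cancel₀ _ hD, Real.cosh_sq a,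
      Real.cosh_sq x]
    ring
  have h2 : 1 - Real.tanh a ^ 2 * normalizedLump a x =
      Real.cosh x ^ 2 / (Real.cosh x ^ 2 + Real.sinh a ^ 2) := by
    rw [normalizedLump, Real.tanh_eq_sinh_div_cosh]
    field_simp
    ring
  rw [h1, h2, lumpLogDeriv]
  field_simp
  ring

theorem hasDerivAt_lumpLogDeriv :
    HasDerivAt (lumpLogDeriv a) (-2 * (1 + Real.tanh a ^ 2) * normalizedLump a x
      + 4 * Real.tanh a ^ 2 * normalizedLump a x ^ 2) x := by
  have hD := (cosh_sq_add_sinh_sq_pos a x).ne'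
  have hc : Real.cosh a ≠ 0 := (Real.cosh_pos a).ne'
  have h : HasDerivAt (lumpLogDeriv a) _ x :=
    (((((Real.hasDerivAt_cosh x).const_mul 2).mul (Real.hasDerivAt_sinh x)).neg).div
    (((Real.hasDerivAt_cosh x).pow 2).add_const (Real.sinh a ^ 2)) hD)
  refine h.congr_deriv ?_
  simp only [normalizedLump, Pi.neg_apply, Pi.mul_apply, Real.tanh_eq_sinh_div_cosh]
  field_simp
  have h1 := Real.cosh_sq a
  have h2 := Real.cosh_sq x
  norm_num
  linear_combination (2 * Real.cosh x ^ 2 - 2 * Real.sinh a ^ 2) * (h1 - h2)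

theorem linearizationPotential_eq_normalizedLump (ha : 0 < a) : linearizationPotential a x =
    4 - 12 * (1 + Real.tanh a ^ 2) * normalizedLump a x
      + 24 * Real.tanh a ^ 2 * normalizedLump a x ^ 2 := by
  have hD := (cosh_sq_add_sinh_sq_pos a x).ne'
  have hc : Real.cosh a ≠ 0 := (Real.cosh_pos a).ne'
  have h1 : Real.cosh (2 * x) + Real.cosh (2 * a)
      = 2 * (Real.cosh x ^ 2 + Real.sinh a ^ 2) := by
    rw [Real.cosh_two_mul, Real.cosh_two_mul, Real.cosh_sq a, Real.cosh_sq x]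
    ring
  rw [linearizationPotential_eq a x ha, h1, normalizedLump, Real.tanh_eq_sinh_div_cosh,
    Real.cosh_two_mul, Real.cosh_two_mul]
  field_simp
  rw [Real.cosh_sq a, Real.cosh_sq x]
  ring

end

/-! ### The mode as ground state -/

section

variable {a r : ℝ} {G : ℂ → ℂ}

/-- The solution `w ^ r * G w` of the linearized equation, `w` being the normalized lump. -/
noncomputable def lumpMode (a r : ℝ) (G : ℂ → ℂ) (x : ℝ) : ℝ :=
  normalizedLump a x ^ r * (G (normalizedLump a x)).re

/-- The derivative of `lumpMode`. -/
noncomputable def lumpModeDeriv (a r : ℝ) (G : ℂ → ℂ) (x : ℝ) : ℝ :=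
  lumpLogDeriv a x * normalizedLump a x ^ r *
    (r * (G (normalizedLump a x)).re + normalizedLump a x * (deriv G (normalizedLump a x)).re)

theorem tanh_sq_mem_Ioo (ha : 0 < a) : Real.tanh a ^ 2 ∈ Set.Ioo (0 : ℝ) 1 := by
  have hs := Real.sinh_pos_iff.2 ha
  have hc := Real.cosh_pos a
  rw [Real.tanh_eq_sinh_div_cosh, div_pow]
  refine ⟨by positivity, (div_lt_one (by positivity)).2 ?_⟩
  rw [Real.cosh_sq]
  linarith

theorem normalizedLump_mem_ball (ha : 0 < a) (x : ℝ) :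
    (normalizedLump a x : ℂ) ∈ Metric.ball (0 : ℂ) (1 / Real.tanh a ^ 2) :=
  ofReal_mem_ball_one_div (tanh_sq_mem_Ioo ha).1 (tanh_sq_mem_Ioo ha).2
    (normalizedLump_mem_Icc a x)

theorem hasDerivAt_normalizedLump_rpow (x : ℝ) :
    HasDerivAt (fun x => normalizedLump a x ^ r)
      (r * lumpLogDeriv a x * normalizedLump a x ^ r) x := by
  have hw := normalizedLump_pos a x
  refine ((hasDerivAt_normalizedLump a x).rpow_const (p := r) (Or.inl hw.ne')).congr_deriv ?_
  rw [Real.rpow_sub_one hw.ne']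
  field_simp

theorem hasDerivAt_re_normalizedLump {F : ℂ → ℂ} {x : ℝ}
    (hF : DifferentiableAt ℂ F (normalizedLump a x)) :
    HasDerivAt (fun x => (F (normalizedLump a x)).re)
      ((deriv F (normalizedLump a x)).re * (lumpLogDeriv a x * normalizedLump a x)) x :=
  (hF.hasDerivAt.real_of_complex).comp x (hasDerivAt_normalizedLump a x)

theorem hasDerivAt_lumpMode (ha : 0 < a)
    (hG : AnalyticOnNhd ℂ G (Metric.ball 0 (1 / Real.tanh a ^ 2))) (x : ℝ) :
    HasDerivAt (lumpMode a r G) (lumpModeDeriv a r G x) x := by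
  refine ((hasDerivAt_normalizedLump_rpow x).mul (hasDerivAt_re_normalizedLump
    (hG _ (normalizedLump_mem_ball ha x)).differentiableAt)).congr_deriv ?_
  rw [lumpModeDeriv]
  ring

theorem hasDerivAt_lumpModeDeriv (ha : 0 < a)
    (hG : AnalyticOnNhd ℂ G (Metric.ball 0 (1 / Real.tanh a ^ 2)))
    (hE : ∀ w ∈ Metric.ball (0 : ℂ) (1 / Real.tanh a ^ 2),
      LumpEquationAt (Real.tanh a ^ 2 : ℝ) r G w) (x : ℝ) :
    HasDerivAt (lumpModeDeriv a r G)
      ((linearizationPotential a x - (4 - 4 * r ^ 2)) * lumpMode a r G x) x := by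
  have hb := normalizedLump_mem_ball ha x
  have h := ((hasDerivAt_lumpLogDeriv a x).mul (hasDerivAt_normalizedLump_rpow (a := a) (r := r) x)).mul
    (((hasDerivAt_re_normalizedLump (hG _ hb).differentiableAt).const_mul r).add
      ((hasDerivAt_normalizedLump a x).mul
        (hasDerivAt_re_normalizedLump (hG.deriv _ hb).differentiableAt)))
  refine h.congr_deriv ?_
  have hode := re_lumpEquation (hE _ hb)
  have hsq := lumpLogDeriv_sq a x
  rw [linearizationPotential_eq_normalizedLump a x ha, lumpMode]
  simp only [Pi.mul_apply, Pi.add_apply]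
  set w := normalizedLump a x
  set g := (G w).re
  set g₁ := (deriv G w).re
  set g₂ := (deriv (deriv G) w).re
  -- The logarithmic derivative enters the second derivative only through its square and its
  -- derivative, both polynomials in w.
  linear_combination (w ^ r * (r * (r * g + w * g₁) + w * (r * g₁ + g₁ + w * g₂))) * hsq
    + (w ^ r * w) * hode

theorem contDiff_normalizedLump : ContDiff ℝ 2 (normalizedLump a) :=
  contDiff_const.div ((Real.contDiff_cosh.pow 2).add contDiff_const)
    fun x => (cosh_sq_add_sinh_sq_pos a x).ne'

theorem contDiff_lumpMode (ha : 0 < a)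
    (hG : AnalyticOnNhd ℂ G (Metric.ball 0 (1 / Real.tanh a ^ 2))) :
    ContDiff ℝ 2 (lumpMode a r G) := by
  refine contDiff_iff_contDiffAt.2 fun x => ?_
  have hw := (contDiff_normalizedLump (a := a)).contDiffAt (x := x)
  refine (hw.rpow_const_of_ne (normalizedLump_pos a x).ne').mul ?_
  have h1 : ContDiffAt ℝ 2 G (normalizedLump a x) :=
    ((hG _ (normalizedLump_mem_ball ha x)).contDiffAt).restrict_scalars ℝ
  have h2 : ContDiffAt ℝ 2 (fun x => (normalizedLump a x : ℂ)) x :=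
    Complex.ofRealCLM.contDiff.contDiffAt.comp x hw
  exact Complex.reCLM.contDiff.contDiffAt.comp x (h1.comp x h2)

theorem continuousOn_re_ofReal {F : ℂ → ℂ} {m : ℝ} (hm : m ∈ Set.Ioo (0 : ℝ) 1)
    (hF : ContinuousOn F (Metric.ball 0 (1 / m))) :
    ContinuousOn (fun x : ℝ => (F x).re) (Set.Icc 0 1) :=
  Complex.continuous_re.comp_continuousOn
    (hF.comp Complex.continuous_ofReal.continuousOn fun _ hx => ofReal_mem_ball_one_div hm.1 hm.2 hx)

/-- Since 0 < w ≤ 1 and r ≥ 1, w^(2r) ≤ w; the crude bound of w by a multiple of 1/(1 + x²) then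
suffices for integrability. -/
theorem exists_lumpMode_sq_le (hr : 1 ≤ r) (ha : 0 < a)
    (hG : AnalyticOnNhd ℂ G (Metric.ball 0 (1 / Real.tanh a ^ 2))) :
    ∃ K, ∀ x, lumpMode a r G x ^ 2 ≤ K * (1 + x ^ 2)⁻¹ := by
  obtain ⟨M, hM⟩ := isCompact_Icc.exists_bound_of_continuousOn
    (continuousOn_re_ofReal (tanh_sq_mem_Ioo ha) hG.continuousOn)
  refine ⟨M ^ 2 * Real.cosh a ^ 2, fun x => ?_⟩
  have hw := normalizedLump_mem_Icc a x
  have h1 : |(G (normalizedLump a x)).re| ≤ M := hM _ hw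
  have h2 : normalizedLump a x ^ r ≤ 1 := Real.rpow_le_one hw.1 hw.2 (by linarith)
  have h3 : normalizedLump a x ^ r ≤ normalizedLump a x := by
    simpa using Real.rpow_le_rpow_of_exponent_ge (normalizedLump_pos a x) hw.2 hr
  have h4 : 0 ≤ normalizedLump a x ^ r := Real.rpow_nonneg hw.1 r
  have h5 : (normalizedLump a x ^ r) ^ 2 ≤ normalizedLump a x := by nlinarith
  calc lumpMode a r G x ^ 2
      = |(G (normalizedLump a x)).re| ^ 2 * (normalizedLump a x ^ r) ^ 2 := by
        rw [lumpMode, mul_pow, sq_abs, mul_comm]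
    _ ≤ M ^ 2 * (Real.cosh a ^ 2 * (1 + x ^ 2)⁻¹) := by
        gcongr
        exact h5.trans (normalizedLump_le a x)
    _ = _ := by ring

theorem integrable_lumpMode_sq (hr : 1 ≤ r) (ha : 0 < a)
    (hG : AnalyticOnNhd ℂ G (Metric.ball 0 (1 / Real.tanh a ^ 2))) :
    Integrable fun x => lumpMode a r G x ^ 2 := by
  obtain ⟨K, hK⟩ := exists_lumpMode_sq_le hr ha hG
  refine (integrable_inv_one_add_sq.const_mul K).mono'
    ((contDiff_lumpMode ha hG).continuous.pow 2).aestronglyMeasurable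
    (Eventually.of_forall fun x => ?_)
  rw [Real.norm_of_nonneg (sq_nonneg _)]
  exact hK x

/-- The logarithmic derivative of the mode is that of w, at most 2 in size, times r + w Re G' / Re
G, which is bounded on [0, 1] because Re G is positive there. -/
theorem exists_abs_lumpModeDeriv_le (ha : 0 < a)
    (hG : AnalyticOnNhd ℂ G (Metric.ball 0 (1 / Real.tanh a ^ 2)))
    (hpos : ∀ x ∈ Set.Icc (0 : ℝ) 1, 0 < (G x).re) :
    ∃ K, ∀ x, |lumpModeDeriv a r G x| ≤ K * lumpMode a r G x := by
  have hm := tanh_sq_mem_Ioo ha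
  have c0 := continuousOn_re_ofReal hm hG.continuousOn
  have c1 := continuousOn_re_ofReal hm hG.deriv.continuousOn
  obtain ⟨M, hM⟩ := isCompact_Icc.exists_bound_of_continuousOn
    (((c0.const_mul r).add (continuousOn_id.mul c1)).div c0 fun x hx => (hpos x hx).ne')
  refine ⟨2 * M, fun x => ?_⟩
  have hw := normalizedLump_mem_Icc a x
  have h1 := hM _ hw
  have hg := hpos _ hw
  simp only [Pi.div_apply, Pi.add_apply, Pi.mul_apply, id, Real.norm_eq_abs, abs_div,
    abs_of_pos hg] at h1
  rw [div_le_iff₀ hg] at h1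
  have h2 : |lumpLogDeriv a x| ≤ 2 := by
    refine abs_le_of_sq_le_sq (?_ : _ ≤ (2 : ℝ) ^ 2) zero_le_two
    rw [lumpLogDeriv_sq]
    have h3 : Real.tanh a ^ 2 * normalizedLump a x ≤ 1 := by nlinarith [hm.2, hw.1, hw.2]
    have h4 : 0 ≤ Real.tanh a ^ 2 * normalizedLump a x := mul_nonneg hm.1.le hw.1
    nlinarith [hw.1, hw.2]
  have h4 : 0 ≤ normalizedLump a x ^ r := Real.rpow_nonneg hw.1 r
  rw [lumpModeDeriv, abs_mul, abs_mul, abs_of_nonneg h4, lumpMode]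
  calc _ ≤ 2 * normalizedLump a x ^ r * (M * (G (normalizedLump a x)).re) := by gcongr
    _ = _ := by ring

theorem isGroundStateEigenvalue_of_lumpEquation (ha : 0 < a) (hr : 1 < r)
    (hG : AnalyticOnNhd ℂ G (Metric.ball 0 (1 / Real.tanh a ^ 2)))
    (hE : ∀ w ∈ Metric.ball (0 : ℂ) (1 / Real.tanh a ^ 2),
      LumpEquationAt (Real.tanh a ^ 2 : ℝ) r G w)
    (hpos : ∀ x ∈ Set.Icc (0 : ℝ) 1, 0 < (G x).re) :
    IsGroundStateEigenvalue a (4 - 4 * r ^ 2) := by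
  have d1 := hasDerivAt_lumpMode (r := r) ha hG
  have d2 := hasDerivAt_lumpModeDeriv ha hG hE
  have hmode : ∀ x, 0 < lumpMode a r G x := fun x =>
    mul_pos (Real.rpow_pos_of_pos (normalizedLump_pos a x) r) (hpos _ (normalizedLump_mem_Icc a x))
  have hiter : ∀ η : ℝ → ℝ, iteratedDeriv 2 η = deriv (deriv η) := fun η => by
    rw [iteratedDeriv_succ, iteratedDeriv_one]
  refine ⟨⟨lumpMode a r G, contDiff_lumpMode ha hG, ?_, fun h => ?_, fun x => ?_⟩, ?_⟩
  · exact (memLp_two_iff_integrable_sq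
      (contDiff_lumpMode ha hG).continuous.aestronglyMeasurable).2
      (integrable_lumpMode_sq hr.le ha hG)
  · exact (hmode 0).ne' (congrFun h 0)
  · rw [hiter, funext fun x => (d1 x).deriv, (d2 x).deriv]
    ring
  · rintro l ⟨η, hη, hint, hne, heq⟩
    obtain ⟨K, hK⟩ := exists_abs_lumpModeDeriv_le (r := r) ha hG hpos
    have hη1 : ContDiff ℝ 1 (deriv η) := (contDiff_succ_iff_deriv (n := 1)).1 hη |>.2.2
    refine le_of_pos_solution hmode d1 d2 hK
      (fun x => (hη.differentiable (by norm_num) x).hasDerivAt)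
      (fun x => (hη1.differentiable (by norm_num) x).hasDerivAt.congr_deriv ?_)
      ((memLp_two_iff_integrable_sq hη.continuous.aestronglyMeasurable).1 hint) hne
    have := heq x
    rw [hiter] at this
    linarith

end

/-! ### Uniqueness of local Heun functions -/

theorem iteratedDeriv_two_eq (F : ℂ → ℂ) : iteratedDeriv 2 F = deriv (deriv F) := by
  rw [iteratedDeriv_succ, iteratedDeriv_one]

section Uniqueness

variable {p q α β γ δ z : ℂ}

theorem eventually_mul_deriv_eq_pow_mul {F E : ℂ → ℂ} {k : ℕ} (hE : AnalyticAt ℂ E 0)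
    (hF : ∀ᶠ z in 𝓝 (0 : ℂ), F z = z ^ k * E z) :
    ∀ᶠ z in 𝓝 (0 : ℂ), z * deriv F z = z ^ k * (k * E z + z * deriv E z) := by
  filter_upwards [hF.eventually_nhds, hE.eventually_analyticAt] with z hz hEz
  have h : HasDerivAt (fun z => z ^ k * E z) _ z :=
    (hasDerivAt_pow k z).mul hEz.differentiableAt.hasDerivAt
  rw [EventuallyEq.deriv_eq hz, h.deriv]
  rcases k with _ | k
  · simp
  · simp only [Nat.add_sub_cancel]
    ring

/-- The exponents at 0 are 0 and 1 - γ. A nonzero solution vanishing to order k + 1 would need γ + k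
= 0. -/
theorem eventually_eq_zero_of_heunEquationAt {D : ℂ → ℂ} (hp : p ≠ 0) (hγ : ∀ n : ℕ, γ + n ≠ 0)
    (hD : AnalyticAt ℂ D 0) (hD0 : D 0 = 0)
    (h : ∀ᶠ z in 𝓝 (0 : ℂ), HeunEquationAt p q α β γ δ D z) : ∀ᶠ z in 𝓝 (0 : ℂ), D z = 0 := by
  by_contra hne
  obtain ⟨k, E, hE, hE0, hDE⟩ := hD.exists_eventuallyEq_pow_smul_nonzero_iff.2 hne
  simp only [sub_zero, smul_eq_mul] at hDE
  obtain ⟨k, rfl⟩ : ∃ j, k = j + 1 := by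
    refine Nat.exists_eq_succ_of_ne_zero ?_
    rintro rfl
    have := hDE.self_of_nhds
    rw [hD0, pow_zero, one_mul] at this
    exact hE0 this.symm
  let E₁ : ℂ → ℂ := fun z => (k + 1 : ℕ) * E z + z * deriv E z
  have hE₁ : AnalyticAt ℂ E₁ 0 :=
    (analyticAt_const.mul hE).add (analyticAt_id.mul hE.deriv)
  let E₂ : ℂ → ℂ := fun z => (k + 1 : ℕ) * E₁ z + z * deriv E₁ z
  have hE₂ : AnalyticAt ℂ E₂ 0 :=
    (analyticAt_const.mul hE₁).add (analyticAt_id.mul hE₁.deriv)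
  have h1 := eventually_mul_deriv_eq_pow_mul hE hDE
  have h2 := eventually_mul_deriv_eq_pow_mul hE₁ h1
  -- z times the Heun operator applied to D, with z^(k+1) factored out; B 0 is the indicial
  -- polynomial at k + 1 times E 0.
  let B : ℂ → ℂ := fun z => (z - 1) * (z - p) * (E₂ z - E₁ z)
    + (γ * (z - 1) * (z - p) + δ * z * (z - p) + (α + β - γ - δ + 1) * z * (z - 1)) * E₁ z
    + z * (α * β * z - q) * E z
  have hB : ∀ᶠ z in 𝓝[≠] (0 : ℂ), B z = 0 := by
    have hall := (((h.and hDE).and (h1.and h2)).and hD.eventually_analyticAt)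
    filter_upwards [hall.filter_mono nhdsWithin_le_nhds, self_mem_nhdsWithin] with z hz hz0
    obtain ⟨⟨⟨hz1, hz2⟩, hz3, hz4⟩, hz5⟩ := hz
    have hd : HasDerivAt (fun z => z * deriv D z) (1 * deriv D z + z * deriv (deriv D) z) z :=
      (hasDerivAt_id' z).mul hz5.deriv.differentiableAt.hasDerivAt
    rw [hd.deriv] at hz4
    rw [HeunEquationAt, iteratedDeriv_two_eq] at hz1
    refine (mul_eq_zero.1 (?_ : z ^ (k + 1) * B z = 0)).resolve_left (pow_ne_zero _ hz0)
    have hz3' : z * deriv D z = z ^ (k + 1) * E₁ z := hz3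
    have hz4' : z * (1 * deriv D z + z * deriv (deriv D) z) = z ^ (k + 1) * E₂ z := hz4
    simp only [B]
    linear_combination z * hz1 - z * (α * β * z - q) * hz2 - (z - 1) * (z - p) * (hz4' - hz3')
      - (γ * (z - 1) * (z - p) + δ * z * (z - p) + (α + β - γ - δ + 1) * z * (z - 1)) * hz3'
  have hBc : ContinuousAt B 0 := by
    have c0 := hE.continuousAt
    have c1 := hE₁.continuousAt
    have c2 := hE₂.continuousAt
    fun_prop
  have hB0 : B 0 = 0 :=
    tendsto_nhds_unique (hBc.tendsto.mono_left nhdsWithin_le_nhds)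
      (tendsto_const_nhds.congr' (hB.mono fun z hz => hz.symm))
  have hfin : p * ((k + 1 : ℕ) * E 0) * (γ + k) = 0 := by
    refine Eq.trans ?_ hB0
    simp only [B, E₂, E₁]
    push_cast
    ring
  have hk : ((k + 1 : ℕ) : ℂ) ≠ 0 := Nat.cast_ne_zero.2 k.succ_ne_zero
  exact mul_ne_zero (mul_ne_zero hp (mul_ne_zero hk hE0)) (hγ k) hfin

theorem IsLocalHeunAlong.analyticAt_zero {H : ℂ → ℂ} (h : IsLocalHeunAlong p q α β γ δ z H) :
    AnalyticAt ℂ H 0 :=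
  h.analytic 0 ⟨0, ⟨le_rfl, zero_lt_one⟩, by simp⟩

theorem IsLocalHeunAlong.eqOn {H₁ H₂ : ℂ → ℂ} (hp : p ≠ 0) (hγ : ∀ n : ℕ, γ + n ≠ 0)
    (h₁ : IsLocalHeunAlong p q α β γ δ z H₁) (h₂ : IsLocalHeunAlong p q α β γ δ z H₂) :
    Set.EqOn H₁ H₂ ((fun t : ℝ => (t : ℂ) * z) '' Set.Ico 0 1) := by
  refine h₁.analytic.eqOn_of_preconnected_of_eventuallyEq h₂.analytic
    (isPreconnected_Ico.image _ (by fun_prop)) (z₀ := 0) ⟨0, ⟨le_rfl, zero_lt_one⟩, by simp⟩ ?_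
  have a₁ := h₁.analyticAt_zero
  have a₂ := h₂.analyticAt_zero
  have key := eventually_eq_zero_of_heunEquationAt (q := q) (α := α) (β := β) (δ := δ) hp hγ
    (a₁.sub a₂) (by simp [h₁.map_zero, h₂.map_zero]) (by
      have e : deriv (H₁ - H₂) =ᶠ[𝓝 0] deriv H₁ - deriv H₂ := by
        filter_upwards [a₁.eventually_analyticAt, a₂.eventually_analyticAt] with z b₁ b₂
        exact deriv_sub b₁.differentiableAt b₂.differentiableAt
      filter_upwards [e.eventually_nhds, a₁.eventually_analyticAt, a₂.eventually_analyticAt,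
        h₁.heun, h₂.heun] with z he b₁ b₂ e₁ e₂
      simp only [HeunEquationAt, iteratedDeriv_two_eq] at e₁ e₂ ⊢
      have he' : deriv (H₁ - H₂) =ᶠ[𝓝 z] deriv H₁ - deriv H₂ := he
      rw [he'.deriv_eq, he'.eq_of_nhds,
        deriv_sub b₁.deriv.differentiableAt b₂.deriv.differentiableAt]
      simp only [Pi.sub_apply]
      linear_combination e₁ - e₂)
  filter_upwards [key] with z hz using sub_eq_zero.1 hz

/-- Uniqueness along the segment makes the choice in `localHeun` immaterial. -/
theorem localHeun_eq {H : ℂ → ℂ} {w : ℂ} (hp : p ≠ 0) (hγ : ∀ n : ℕ, γ + n ≠ 0)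
    (hH : IsLocalHeunAlong p q α β γ δ z H)
    (hlim : Tendsto (fun t : ℝ => H ((t : ℂ) * z)) (𝓝[<] 1) (𝓝 w)) :
    localHeun p q α β γ δ z = w := by
  have hex : ∃ w, IsLocalHeunValue p q α β γ δ z w := ⟨w, H, hH, hlim⟩
  rw [localHeun, dif_pos hex]
  obtain ⟨H', hH', hlim'⟩ := hex.choose_spec
  refine tendsto_nhds_unique hlim' (hlim.congr' ?_)
  filter_upwards [Ioo_mem_nhdsLT (zero_lt_one' ℝ)] with t ht
  exact hH.eqOn hp hγ hH' ⟨t, ⟨ht.1.le, ht.2⟩, rfl⟩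

end Uniqueness

/-! ### Passage to Heun's equation -/

theorem HeunEquationAt.comp_one_sub {p q α β γ δ z : ℂ} {H : ℂ → ℂ} (K : ℂ)
    (h : HeunEquationAt p q α β γ δ H (1 - z)) :
    HeunEquationAt (1 - p) (α * β - q) α β δ γ (fun z => K * H (1 - z)) z := by
  have h1 : deriv (fun z => K * H (1 - z)) = fun z => -K * deriv H (1 - z) := funext fun z => by
    rw [deriv_const_mul_field, deriv_comp_const_sub]
    ring
  simp only [HeunEquationAt, iteratedDeriv_two_eq] at h ⊢
  rw [h1, deriv_const_mul_field, deriv_comp_const_sub]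
  linear_combination (-K) * h

section HeunTransform

variable {S r : ℝ} {G : ℂ → ℂ}

/-- The transform of a solution of the lump equation to Heun's equation. -/
noncomputable def heunTransform (S r : ℝ) (G : ℂ → ℂ) (z : ℂ) : ℂ :=
  (1 + S * z) ^ (-(r + 3) : ℂ) * G ((1 + S) * z / (1 + S * z))

/-- The domain on which `heunTransform` is analytic. -/
def heunDomain (S : ℝ) : Set ℂ :=
  {z | 1 + S * z ∈ Complex.slitPlane ∧
    (1 + S) * z / (1 + S * z) ∈ Metric.ball (0 : ℂ) (1 / (S / (1 + S)))}

theorem isOpen_heunDomain : IsOpen (heunDomain S) := by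
  have h1 : IsOpen {z : ℂ | 1 + S * z ∈ Complex.slitPlane} :=
    Complex.isOpen_slitPlane.preimage (by fun_prop)
  have h2 : ContinuousOn (fun z : ℂ => (1 + S) * z / (1 + S * z))
      {z : ℂ | 1 + S * z ∈ Complex.slitPlane} :=
    ContinuousOn.div (by fun_prop) (by fun_prop) fun z hz => Complex.slitPlane_ne_zero hz
  exact h2.isOpen_inter_preimage h1 Metric.isOpen_ball

theorem ofReal_mem_heunDomain (hS : 0 < S) {t : ℝ} (ht : t ∈ Set.Icc (0 : ℝ) 1) :
    (t : ℂ) ∈ heunDomain S := by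
  have h1 : 0 < 1 + S * t := by have := mul_nonneg hS.le ht.1; linarith
  refine ⟨Complex.mem_slitPlane_iff.2 (Or.inl (by simpa using h1)), ?_⟩
  have h2 := ofReal_mem_ball_one_div (m := S / (1 + S)) (by positivity)
    ((div_lt_one (by positivity)).2 (by linarith)) (x := (1 + S) * t / (1 + S * t))
    ⟨div_nonneg (mul_nonneg (by linarith) ht.1) h1.le, (div_le_one h1).2 (by linarith [ht.2])⟩
  push_cast at h2
  exact h2

theorem analyticOnNhd_heunTransform (hG : AnalyticOnNhd ℂ G (Metric.ball 0 (1 / (S / (1 + S))))) :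
    AnalyticOnNhd ℂ (heunTransform S r G) (heunDomain S) := fun z hz => by
  have h1 : AnalyticAt ℂ (fun z : ℂ => 1 + S * z) z := by fun_prop
  have h2 : AnalyticAt ℂ (fun z : ℂ => (1 + S) * z / (1 + S * z)) z :=
    AnalyticAt.div (by fun_prop) h1 (Complex.slitPlane_ne_zero hz.1)
  exact (h1.cpow analyticAt_const hz.1).mul 
    (AnalyticAt.fun_comp (g := G) (hG _ hz.2) h2)

/-- The Möbius map w = (1 + S) z / (1 + S z) fixes 0 and 1, sends ∞ to 1/m and p = -1/S to ∞. At w =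
∞ the solutions G behave like w^(-(r+3)) and w^(2-r); the prefactor shifts the first exponent to 0,
as Heun's form requires at p. -/
theorem heunEquationAt_heunTransform (hS : 0 < S)
    (hG : AnalyticOnNhd ℂ G (Metric.ball 0 (1 / (S / (1 + S)))))
    (hE : ∀ w ∈ Metric.ball (0 : ℂ) (1 / (S / (1 + S))), LumpEquationAt (S / (1 + S) : ℝ) r G w)
    {z : ℂ} (hz : z ∈ heunDomain S) :
    HeunEquationAt (-1 / S)
      ((6 * (1 + 2 * S) * (2 * r + 3) - (2 * r + 6) * (2 * r + 1)) / (4 * S))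
      (r + 3) (r + 7 / 2) (2 * r + 1) (1 / 2) (heunTransform S r G) z := by
  have hw : ∀ z ∈ heunDomain S, HasDerivAt (fun z : ℂ => (1 + S) * z / (1 + S * z))
      ((1 + S) / (1 + S * z) ^ 2) z := fun z hz => by
    have hd := Complex.slitPlane_ne_zero hz.1
    refine (((hasDerivAt_id' z).const_mul (1 + S : ℂ)).div
      (((hasDerivAt_id' z).const_mul (S : ℂ)).const_add 1) hd).congr_deriv ?_
    field_simp
    ring
  have hP : ∀ z ∈ heunDomain S, HasDerivAt (fun z : ℂ => (1 + S * z) ^ (-(r + 3) : ℂ))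
      ((1 + S * z) ^ (-(r + 3) : ℂ) * (-(r + 3) * S / (1 + S * z))) z := fun z hz => by
    have hd := Complex.slitPlane_ne_zero hz.1
    have hi : HasDerivAt (fun z : ℂ => 1 + S * z) S z := by
      simpa using ((hasDerivAt_id' z).const_mul (S : ℂ)).const_add 1
    refine (hi.cpow_const (c := (-(r + 3) : ℂ)) hz.1).congr_deriv ?_
    rw [Complex.cpow_sub _ _ hd, Complex.cpow_one]
    field_simp
  have hcomp : ∀ {F : ℂ → ℂ}, AnalyticOnNhd ℂ F (Metric.ball 0 (1 / (S / (1 + S)))) →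
      ∀ z ∈ heunDomain S, HasDerivAt (fun z : ℂ => F ((1 + S) * z / (1 + S * z)))
        (deriv F ((1 + S) * z / (1 + S * z)) * ((1 + S) / (1 + S * z) ^ 2)) z := fun hF z hz =>
    (hF _ hz.2).differentiableAt.hasDerivAt.comp z (hw z hz)
  have h1 : ∀ z ∈ heunDomain S, HasDerivAt (heunTransform S r G)
      ((1 + S * z) ^ (-(r + 3) : ℂ) * (-(r + 3) * S * (1 + S * z)⁻¹ *
        G ((1 + S) * z / (1 + S * z)) + (1 + S) * ((1 + S * z)⁻¹ ^ 2) *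
        deriv G ((1 + S) * z / (1 + S * z)))) z := fun z hz => by
    refine ((hP z hz).mul (hcomp hG z hz)).congr_deriv ?_
    simp only [div_eq_mul_inv, ← inv_pow]
    ring
  have hd := Complex.slitPlane_ne_zero hz.1
  have hinv : HasDerivAt (fun z : ℂ => (1 + S * z)⁻¹) (-S / (1 + S * z) ^ 2) z := by
    have hi : HasDerivAt (fun z : ℂ => 1 + S * z) S z := by
      simpa using ((hasDerivAt_id' z).const_mul (S : ℂ)).const_add 1
    exact hi.inv hd
  have h2 := ((hP z hz).mul (((hinv.const_mul (-(r + 3) * S : ℂ)).mul (hcomp hG z hz)).add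
    (((hinv.pow 2).const_mul (1 + S : ℂ)).mul (hcomp hG.deriv z hz))))
  have hev := eventually_of_mem (isOpen_heunDomain.mem_nhds hz) fun v hv => (h1 v hv).deriv
  have hode := hE _ hz.2
  rw [HeunEquationAt, iteratedDeriv_two_eq, (h2.congr_of_eventuallyEq hev).deriv, (h1 z hz).deriv]
  simp only [LumpEquationAt, heunTransform, Pi.mul_apply, Pi.add_apply, Pi.pow_apply] at hode ⊢
  have hS0 : (S : ℂ) ≠ 0 := Complex.ofReal_ne_zero.2 hS.ne'
  have hS1 : (1 + S : ℂ) ≠ 0 := by exact_mod_cast (by positivity : (1 + S : ℝ) ≠ 0)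
  push_cast at hode ⊢
  set w := (1 + S) * z / (1 + S * z) with hwdef
  generalize G w = g at *
  generalize deriv G w = g₁ at *
  generalize deriv (deriv G) w = g₂ at *
  generalize (1 + S * z) ^ (-(r + 3) : ℂ) = e at *
  clear_value w
  subst hwdef
  clear h2 hev h1 hinv hcomp hP hw hE hG hz
  generalize (S : ℂ) = s at *
  generalize (r : ℂ) = ρ at *
  -- With d as the variable all denominators are monomials in d and s, up to the constant 1 + s.
  obtain ⟨d, hds⟩ : ∃ d, d = 1 + s * z := ⟨_, rfl⟩
  rw [← hds] at hd hode ⊢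
  obtain rfl : z = (d - 1) / s := by
    rw [hds]
    field_simp
    ring
  linear_combination (norm := skip) (-(e * (1 + s) / (4 * s))) * hode
  field_simp
  ring

end HeunTransform

/-! ### The connection equation -/

theorem isLocalHeunAlong_of_heunDomain {S : ℝ} {p q α β γ δ : ℂ} {H : ℂ → ℂ} (hS : 0 < S)
    (hH : AnalyticOnNhd ℂ H (heunDomain S)) (hH0 : H 0 = 1)
    (hE : ∀ z ∈ heunDomain S, HeunEquationAt p q α β γ δ H z) :
    IsLocalHeunAlong p q α β γ δ 1 H where
  analytic := by
    rintro _ ⟨t, ht, rfl⟩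
    simpa using hH _ (ofReal_mem_heunDomain hS ⟨ht.1, ht.2.le⟩)
  map_zero := hH0
  heun := eventually_of_mem (isOpen_heunDomain.mem_nhds
    (by simpa using ofReal_mem_heunDomain hS (t := 0) (by simp))) hE

theorem isLocalHeunAlong_one_sub_of_heunDomain {S : ℝ} {p q α β γ δ : ℂ} {H : ℂ → ℂ} (hS : 0 < S)
    (hH : AnalyticOnNhd ℂ H (heunDomain S)) (hH1 : H 1 ≠ 0)
    (hE : ∀ z ∈ heunDomain S, HeunEquationAt p q α β γ δ H z) :
    IsLocalHeunAlong (1 - p) (α * β - q) α β δ γ 1 fun z => (H 1)⁻¹ * H (1 - z) where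
  analytic := by
    rintro _ ⟨t, ht, rfl⟩
    have h1 := ofReal_mem_heunDomain hS (t := 1 - t) ⟨by linarith [ht.2], by linarith [ht.1]⟩
    push_cast at h1
    have h2 : AnalyticAt ℂ (fun z : ℂ => 1 - z) (t * 1 : ℂ) := by fun_prop
    refine analyticAt_const.mul (AnalyticAt.fun_comp (g := H) ?_ h2)
    simpa using hH _ h1
  map_zero := by simp [hH1]
  heun := by
    have h1 : (1 - 0 : ℂ) ∈ heunDomain S := by
      simpa using ofReal_mem_heunDomain hS (t := 1) (by simp)
    have h2 : ContinuousAt (fun z : ℂ => 1 - z) 0 := by fun_prop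
    filter_upwards [h2.preimage_mem_nhds (isOpen_heunDomain.mem_nhds h1)] with z hz
    exact (hE _ hz).comp_one_sub _

/-- H is the local solution at 0, and H(1 - z)/H(1) is the local solution of the reflected equation;
their limits at 1 are H(1) and H(0)/H(1). -/
theorem localHeun_mul_localHeun_eq_one {S : ℝ} {p q α β γ δ : ℂ} {H : ℂ → ℂ} (hS : 0 < S)
    (hp0 : p ≠ 0) (hp1 : 1 - p ≠ 0) (hγ : ∀ n : ℕ, γ + n ≠ 0) (hδ : ∀ n : ℕ, δ + n ≠ 0)
    (hH : AnalyticOnNhd ℂ H (heunDomain S)) (hH0 : H 0 = 1) (hH1 : H 1 ≠ 0)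
    (hE : ∀ z ∈ heunDomain S, HeunEquationAt p q α β γ δ H z) :
    localHeun p q α β γ δ 1 * localHeun (1 - p) (α * β - q) α β δ γ 1 = 1 := by
  have c0 : ContinuousAt H 0 :=
    (hH 0 (by simpa using ofReal_mem_heunDomain hS (t := 0) (by simp))).continuousAt
  have c1 : ContinuousAt H 1 :=
    (hH 1 (by simpa using ofReal_mem_heunDomain hS (t := 1) (by simp))).continuousAt
  have t1 : Tendsto (fun t : ℝ => (t : ℂ) * 1) (𝓝[<] 1) (𝓝 1) := by
    have : Continuous fun t : ℝ => (t : ℂ) * 1 := by fun_prop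
    simpa using (this.tendsto 1).mono_left nhdsWithin_le_nhds
  have t0 : Tendsto (fun t : ℝ => 1 - (t : ℂ) * 1) (𝓝[<] 1) (𝓝 0) := by
    simpa using t1.const_sub 1
  rw [localHeun_eq hp0 hγ (isLocalHeunAlong_of_heunDomain hS hH hH0 hE) (c1.tendsto.comp t1),
    localHeun_eq hp1 hδ (isLocalHeunAlong_one_sub_of_heunDomain hS hH hH1 hE)
      ((c0.tendsto.comp t0).const_mul _), hH0, mul_one, mul_inv_cancel₀ hH1]

theorem tanh_sq_eq_sinh_sq_div (a : ℝ) :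
    Real.tanh a ^ 2 = Real.sinh a ^ 2 / (1 + Real.sinh a ^ 2) := by
  rw [Real.tanh_eq_sinh_div_cosh, div_pow, Real.cosh_sq, add_comm]

theorem theorem1 (a : ℝ) (ha : 0 < a) :
    ∃ lam : ℝ, IsGroundStateEigenvalue a lam ∧ lam < 0 ∧
      localHeun (heunP a) (heunQ a lam) (heunAlpha lam) (heunBeta lam) (heunGamma lam) heunDelta 1
        * localHeun (1 - heunP a) (heunAlpha lam * heunBeta lam - heunQ a lam)
            (heunAlpha lam) (heunBeta lam) heunDelta (heunGamma lam) 1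
        - 1 = 0 := by
  have hm := tanh_sq_mem_Ioo ha
  obtain ⟨r, hr1, -, hle⟩ := exists_lumpCoeff_le hm.1 hm.2
  obtain ⟨G, hG, hG0, hE⟩ := exists_analytic_lumpEquation hm.1 (by linarith : 0 < r)
    (exists_abs_lumpCoeff_le hm.1 hle)
  have hpos : ∀ x ∈ Set.Icc (0 : ℝ) 1, 0 < (G x).re := fun x hx =>
    re_pos_of_lumpEquation hm.1 hm.2 hr1 hG hG0 hE hx
  refine ⟨4 - 4 * r ^ 2, isGroundStateEigenvalue_of_lumpEquation ha hr1 hG hE hpos,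
    by nlinarith, ?_⟩
  have hS : 0 < Real.sinh a ^ 2 := pow_pos (Real.sinh_pos_iff.2 ha) 2
  have hS0 : (Real.sinh a ^ 2 : ℂ) ≠ 0 := by exact_mod_cast hS.ne'
  have hsqrt : √(4 - (4 - 4 * r ^ 2)) = 2 * r := by
    rw [show 4 - (4 - 4 * r ^ 2) = (2 * r) ^ 2 by ring, Real.sqrt_sq (by linarith)]
  have hcosh : Real.cosh (2 * a) = 1 + 2 * Real.sinh a ^ 2 := by
    rw [Real.cosh_two_mul, Real.cosh_sq]
    ring
  set S := Real.sinh a ^ 2 with hSdef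
  rw [tanh_sq_eq_sinh_sq_div a, ← hSdef] at hE
  have hball : Metric.ball (0 : ℂ) (1 / Real.tanh a ^ 2) = Metric.ball 0 (1 / (S / (1 + S))) := by
    rw [tanh_sq_eq_sinh_sq_div a]
  rw [hball] at hG
  have hH : AnalyticOnNhd ℂ (heunTransform S r G) (heunDomain S) := analyticOnNhd_heunTransform hG
  have hH0 : heunTransform S r G 0 = 1 := by simp [heunTransform, hG0]
  have hSc : (1 + S : ℂ) ≠ 0 := by exact_mod_cast (by positivity : 1 + S ≠ 0)
  have hH1 : heunTransform S r G 1 ≠ 0 := by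
    have h1 := hpos 1 (by simp)
    have h2 : G 1 ≠ 0 := fun h => by simp [h] at h1
    have h3 : (1 + S : ℂ) * 1 / (1 + S * 1) = 1 := by
      rw [mul_one, mul_one, div_self hSc]
    rw [heunTransform, h3, mul_one]
    exact mul_ne_zero (by simp [Complex.cpow_eq_zero_iff, hSc]) h2
  have hp : (heunP a : ℂ) = -1 / S := by simp [heunP, hSdef]
  have hq : (heunQ a (4 - 4 * r ^ 2) : ℂ) =
      (6 * (1 + 2 * S) * (2 * r + 3) - (2 * r + 6) * (2 * r + 1)) / (4 * S) := by
    rw [heunQ, hsqrt, hcosh, ← hSdef]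
    push_cast
    ring
  have hα : (heunAlpha (4 - 4 * r ^ 2) : ℂ) = r + 3 := by
    rw [heunAlpha, hsqrt]
    push_cast
    ring
  have hβ : (heunBeta (4 - 4 * r ^ 2) : ℂ) = r + 7 / 2 := by
    rw [heunBeta, hsqrt]
    push_cast
    ring
  have hγ : (heunGamma (4 - 4 * r ^ 2) : ℂ) = 2 * r + 1 := by
    rw [heunGamma, hsqrt]
    push_cast
    ring
  have hδ : (heunDelta : ℂ) = 1 / 2 := by simp [heunDelta]
  rw [hp, hq, hα, hβ, hγ, hδ, sub_eq_zero]
  refine localHeun_mul_localHeun_eq_one hS ?_ ?_ (fun n => ?_) (fun n => ?_) hH hH0 hH1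
    fun z hz => heunEquationAt_heunTransform hS hG hE hz
  · exact_mod_cast (div_neg_of_neg_of_pos (by norm_num) hS : -1 / S < 0).ne
  · have : -1 / S < 0 := div_neg_of_neg_of_pos (by norm_num) hS
    exact_mod_cast (by linarith : 0 < 1 - -1 / S).ne'
  · exact_mod_cast (by positivity : 0 < 2 * r + 1 + n).ne'
  · have h : (1 / 2 + n : ℂ) = ((1 / 2 + n : ℝ) : ℂ) := by push_cast; rfl
    rw [h]
    exact Complex.ofReal_ne_zero.2 (by positivity)
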